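/- Let $\mathcal A$ be the Neveu–Schwarz Lie superalgebra over $\mathbb C$, with basis $L_n$ ($n\in\mathbb Z$), $G_r$ ($r\in\mathbb Z+\frac12$), $C$ (central) and relations $$[L_m,L_n]=(m-n)L_{m+n}+\tfrac{m^3-m}{12}\delta_{m+n,0}C,\quad [L_m,G_r]=(\tfrac m2-r)G_{m+r},\quad [G_r,G_s]_+=2L_{r+s}+\tfrac13(r^2-\tfrac14)\delta_{r+s,0}C .$$ Let $p,q\ge 2$ be integers with $p\equiv q \pmod 2$ and $\gcd(p,\frac{p-q}2)=1$, and put $c_{p,q}=\frac32\left(1-\frac{2(p-q)^2}{pq}\right)$. Let $V_{p,q}=V(c_{p,q},0)$ be the Verma module over $\mathcal A$ of central charge $c_{p,q}$ and highest weight $0$, with highest weight vector $1$. A singular vector is a non-zero vector killed by all $L_n$ and $G_r$ with $n,r>0$. One singular vector is $G_{-1/2}1$; let $w$ be the second one, that is, a singular vector of degree ($L_0$-eigenvalue) $\frac12(p-1)(q-1)$ that does not lie in the submodule generated by $G_{-1/2}1$. Let $V'_{p,q}=V_{p,q}/\langle G_{-1/2}1\rangle$ and let $w'$ be the image of $w$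 in $V'_{p,q}$. To a monomial $$G_{m_1}\cdots G_{m_s}L_{n_1}\cdots L_{n_\ell}1\in V'_{p,q},\qquad -\tfrac32\ge m_1>\dots>m_s,\quad -2\ge n_1\ge\dots\ge n_\ell,$$ assign the sequence $(\beta_0,\beta_1,\dots)$ where $\beta_0=s+\ell$ and, for $i\ge1$, $\beta_i$ is the number of the $m_j$ and $n_j$ equal to $-1-\frac i2$. Order finitely supported sequences of non-negative integers lexicographically (the first differing entry decides), and let $F_\alpha V'_{p,q}$ be the span of the monomials whose sequence is $\le\alpha$. An element has filtration degree lower than $\alpha$ if it lies in $F_\beta V'_{p,q}$ for some $\beta<\alpha$. Then: (1) If $(p-1)(q-1)$ is even, then $m=\frac{(p-1)(q-1)}4$ and $k=m-2$ are non-negative integers, and there is a non-zero $\lambda\in\mathbb C$ such that some non-zero multiple of $w'$ equals $$G_{-5/2}G_{-3/2}L_{-2}^k1+\lambda L_{-2}^m1$$ plus an element of filtration degree lower than that of $L_{-2}^m1$ (which is itself lower than that of $G_{-3/2}G_{-5/2}L_{-2}^k1$). (2) If $(p-1)(q-1)$ is odd, then $k=\frac{(p-1)(q-1)-3}4$ is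 a non-negative integer, and some non-zero multiple of $w'$ equals $$G_{-3/2}L_{-2}^k1$$ plus an element of filtration degree lower than that of $G_{-3/2}L_{-2}^k1$. -/

import Mathlib

namespace NeveuSchwarz

/-- Symbols for the standard basis of the Neveu-Schwarz Lie superalgebra. Half-integers are
encoded by integers: `G k` stands for the odd basis element `G_{k + 1/2}`, so that
`G (-1)`, `G (-2)`, `G (-3)` are `G_{-1/2}`, `G_{-3/2}`, `G_{-5/2}`. -/
inductive Gen : Type
  | L (n : ℤ)
  | G (k : ℤ)
  | C

/-- The generator `L_n` in the free algebra. -/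
def fL (n : ℤ) : FreeAlgebra ℂ Gen := FreeAlgebra.ι ℂ (Gen.L n)

/-- The generator `G_{k + 1/2}` in the free algebra. -/
def fG (k : ℤ) : FreeAlgebra ℂ Gen := FreeAlgebra.ι ℂ (Gen.G k)

/-- The central generator in the free algebra. -/
def fC : FreeAlgebra ℂ Gen := FreeAlgebra.ι ℂ Gen.C

/-- The defining relations of the Neveu-Schwarz algebra: with `r = j + 1/2`, `s = k + 1/2`,
* `[L_m, L_n] = (m - n) L_{m+n} + δ_{m+n,0} (m³ - m)/12 C`,
* `[L_m, G_s] = (m/2 - s) G_{m+s}`,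
* `{G_r, G_s} = 2 L_{r+s} + δ_{r+s,0} (r² - 1/4)/3 C`,
* `C` is central. -/
inductive Rel : FreeAlgebra ℂ Gen → FreeAlgebra ℂ Gen → Prop
  | LL (m n : ℤ) : Rel (fL m * fL n - fL n * fL m)
      (((m : ℂ) - n) • fL (m + n) +
        (if m + n = 0 then ((m : ℂ) ^ 3 - m) / 12 else 0) • fC)
  | LG (m k : ℤ) : Rel (fL m * fG k - fG k * fL m)
      (((m : ℂ) / 2 - ((k : ℂ) + 1 / 2)) • fG (m + k))
  | GG (j k : ℤ) : Rel (fG j * fG k + fG k * fG j)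
      ((2 : ℂ) • fL (j + k + 1) +
        (if j + k + 1 = 0 then (((j : ℂ) + 1 / 2) ^ 2 - 1 / 4) / 3 else 0) • fC)
  | CL (n : ℤ) : Rel (fC * fL n) (fL n * fC)
  | CG (k : ℤ) : Rel (fC * fG k) (fG k * fC)

/-- The universal enveloping algebra of the Neveu-Schwarz Lie superalgebra over `ℂ`.
Modules over the Neveu-Schwarz algebra are modules over this associative algebra. -/
abbrev U : Type := RingQuot Rel

/-- The element `L_n`. -/
noncomputable def L (n : ℤ) : U := RingQuot.mkAlgHom ℂ Rel (fL n)

/-- The element `G_{k + 1/2}`. -/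
noncomputable def G (k : ℤ) : U := RingQuot.mkAlgHom ℂ Rel (fG k)

/-- The central element. -/
noncomputable def C : U := RingQuot.mkAlgHom ℂ Rel fC

/-- The left ideal generated by `L_n` (`n > 0`), `G_r` (`r > 0`), `L_0 - h` and `C - c`. -/
noncomputable def vermaIdeal (c h : ℂ) : Submodule U U :=
  Submodule.span U
    ({x | ∃ n : ℤ, 0 < n ∧ x = L n} ∪ {x | ∃ k : ℤ, 0 ≤ k ∧ x = G k} ∪
      {L 0 - algebraMap ℂ U h, C - algebraMap ℂ U c})

/-- The Verma module `V(c, h)` of central charge `c` and highest weight `h`. -/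
abbrev Verma (c h : ℂ) : Type := U ⧸ vermaIdeal c h

/-- The highest weight vector `1` of the Verma module `V(c, h)`. -/
noncomputable def vac (c h : ℂ) : Verma c h := (vermaIdeal c h).mkQ 1

/-- A singular vector of a module over the Neveu-Schwarz algebra: a non-zero vector killed by
all `L_n` with `n > 0` and all `G_r` with `r > 0`. -/
def IsSingular {M : Type*} [AddCommGroup M] [Module U M] (v : M) : Prop :=
  v ≠ 0 ∧ (∀ n : ℤ, 0 < n → L n • v = 0) ∧ (∀ k : ℤ, 0 ≤ k → G k • v = 0)

/-- The central charge `c_{p,q} = (3/2) (1 - 2 (p - q)² / (p q))`. -/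
noncomputable def cMin (p q : ℤ) : ℂ :=
  3 / 2 * (1 - 2 * ((p : ℂ) - q) ^ 2 / ((p : ℂ) * q))

/-- The submodule of `V_{p,q} = V(c_{p,q}, 0)` generated by the singular vector `G_{-1/2} 1`. -/
noncomputable def firstSub (p q : ℤ) : Submodule U (Verma (cMin p q) 0) :=
  Submodule.span U {G (-1) • vac (cMin p q) 0}

/-- `w` is the second singular vector of `V_{p,q}`: a singular vector of degree
`(p - 1)(q - 1)/2` (the degree is the eigenvalue of `L_0`, the highest weight being `0`) which is
not a descendant of the first singular vector `G_{-1/2} 1`. -/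
def IsSecondSingular (p q : ℤ) (w : Verma (cMin p q) 0) : Prop :=
  IsSingular w ∧ L 0 • w = (((p : ℂ) - 1) * ((q : ℂ) - 1) / 2) • w ∧ w ∉ firstSub p q

/-- The quotient `V'_{p,q}` of `V_{p,q}` by the submodule generated by `G_{-1/2} 1`. -/
abbrev VPrime (p q : ℤ) : Type := Verma (cMin p q) 0 ⧸ firstSub p q

/-- The projection `V_{p,q} → V'_{p,q}`. -/
noncomputable def proj (p q : ℤ) : Verma (cMin p q) 0 →ₗ[U] VPrime p q := (firstSub p q).mkQ

/-- The image of the highest weight vector in `V'_{p,q}`. -/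
noncomputable def vac' (p q : ℤ) : VPrime p q := proj p q (vac (cMin p q) 0)

/-- An index of a monomial `G_{m_1} ⋯ G_{m_k} L_{n_1} ⋯ L_{n_ℓ}` with
`-3/2 ≥ m_1 > ⋯ > m_k` and `-2 ≥ n_1 ≥ ⋯ ≥ n_ℓ`. The list `gs` holds the integers
`m_i - 1/2`, and `ls` holds the `n_j`. -/
structure MonIndex where
  gs : List ℤ
  ls : List ℤ
  gs_le : ∀ k ∈ gs, k ≤ -2
  ls_le : ∀ n ∈ ls, n ≤ -2
  gs_desc : gs.Pairwise (· > ·)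
  ls_desc : ls.Pairwise (· ≥ ·)

/-- The monomial `G_{m_1} ⋯ G_{m_k} L_{n_1} ⋯ L_{n_ℓ}` as an element of the enveloping algebra. -/
noncomputable def MonIndex.mon (I : MonIndex) : U := (I.gs.map G).prod * (I.ls.map L).prod

/-- The sequence `(β_0, β_1, β_2, …)` of a monomial: `β_0 = k + ℓ`, and for `i ≥ 1` the entry `β_i`
is the number of the `m`'s and `n`'s equal to `-1 - i/2`. Here `m = k + 1/2` equals `-1 - i/2` when
`i = -2 k - 3`, and `n` equals `-1 - i/2` when `i = -2 n - 2`; both values are positive. The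
sequences are ordered lexicographically. -/
noncomputable def MonIndex.deg (I : MonIndex) : Lex (ℕ →₀ ℕ) :=
  toLex (Finsupp.single 0 (I.gs.length + I.ls.length) +
    Multiset.toFinsupp
      ((I.gs.map (fun k => (-2 * k - 3).toNat) ++
        I.ls.map (fun n => (-2 * n - 2).toNat) : List ℕ) : Multiset ℕ))

/-- The filtration `F_α V'_{p,q}`: the span of all monomials whose sequence is at most `α`. -/
noncomputable def filt (p q : ℤ) (α : Lex (ℕ →₀ ℕ)) : Submodule ℂ (VPrime p q) :=
  Submodule.span ℂ {v | ∃ I : MonIndex, I.deg ≤ α ∧ v = I.mon • vac' p q}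

/-- `v` is of filtration degree lower than `α`. -/
def IsLower (p q : ℤ) (α : Lex (ℕ →₀ ℕ)) (v : VPrime p q) : Prop :=
  ∃ β < α, v ∈ filt p q β

/-- The index of the monomial `L_{-2}^m`. -/
def lIndex (m : ℕ) : MonIndex where
  gs := []
  ls := List.replicate m (-2)
  gs_le := by simp
  ls_le := by
    intro n hn
    exact (List.eq_of_mem_replicate hn).le
  gs_desc := by simp
  ls_desc := by simp [List.pairwise_replicate]

/-- The index of the monomial `G_{-3/2} L_{-2}^k`. -/
def glIndex (k : ℕ) : MonIndex where
  gs := [-2]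
  ls := List.replicate k (-2)
  gs_le := by simp
  ls_le := by
    intro n hn
    exact (List.eq_of_mem_replicate hn).le
  gs_desc := by simp
  ls_desc := by simp [List.pairwise_replicate]

end NeveuSchwarz

/-!
The module `V'_{p,q}` is compared with a free-field module. Let `a_n` (`n ∈ ℤ`, `a_0 = 0`) and
`ψ_r` (`r ∈ ℤ + 1/2`) be the modes of a free boson and of a free Neveu-Schwarz fermion, acting on
the Fock space `Fock`, and put

  `G_r = ∑ a_n ψ_{r - n} + κ (r + 1/2) ψ_r`.

These operators generate a representation of the Neveu-Schwarz algebra of central charge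
`3/2 - 3 κ²` (`gAnti_eq`, `lOp_gOp`, `lOp_lOp`). If `κ² = (p - q)² / (p q)`, the central charge is
`c_{p,q}`; as the vacuum is killed by all `L_n` with `n ≥ -1` and all `G_r` with `r ≥ -1/2`, the
highest weight vector of `V'_{p,q}` can be sent to it (`exists_fockMap`).

Give `a_{-1}` weight `2` and every other creation operator weight `1`. Modulo terms of lower
weight, `G_r` with `r ≤ -3/2` acts as `a_{-1} ψ_{r+1}`, and `L_n` with `n ≤ -2` acts as a non-zero
multiple of `a_{-1} a_{n+1}` (`gOp_lead`, `lOp_lead`). So the ordered monomials applied to the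
vacuum have pairwise different leading terms, and since they span `V'_{p,q}`
(`wordSpan_le_monSpan`), they form a basis of `V'_{p,q}`, which embeds in the Fock space
(`fockMap_injective`).

For `n > 0` and `r > 0` the leading parts of `L_n` and `G_r` are `a_{-1} a_{n+1}` and
`a_{-1} ψ_{r+1}`. A vector killed by all of them therefore has no `a_{-n}` with `n ≥ 2` and no
`ψ_{-r}` with `r ≥ 3/2` in its part of top weight (`singular_top`). Consequently a singular vector
of degree `N` contains `a_{-1}^N` or `a_{-1}^{N-1/2} ψ_{-1/2}`, a term of weight `2 N` in
either case (`exists_top`). A product of `s` modes `G` and `ℓ` modes `L` reaches weight at most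
`3 s + 4 ℓ`, and this forces the singular vector to involve

* `L_{-2}^m` if `N = 2 m`,
* `G_{-3/2} L_{-2}^k` if `N = 2 k + 3/2`.

In the second case it is the only monomial of degree `N` with that many factors, and the claim
follows. In the first case exactly one other monomial of degree `N` has `m` factors, namely
`G_{-3/2} G_{-5/2} L_{-2}^{m-2}`. If `a` and `b` are the coefficients of it and of `L_{-2}^m`, the
coefficient of `G_{-3/2} L_{-2}^{m-1}` in `G_{1/2} w'` is `(3/2) m b - 2 a`. It vanishes, so that
`a = (3/4) m b ≠ 0`. Reordering the two odd factors changes the sign of the first coefficient and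
gives `λ = -4 / (3 m)` (`leading_even`).
-/

namespace NeveuSchwarz

/-! ### The Fock space of a free boson and a free fermion -/

/-- Occupation numbers of a basis vector of the Fock space: the pair `(μ, S)` records that the
creation operator `a_{-i-1}` occurs `μ i` times, and that `ψ_{-k-1/2}` occurs exactly when
`k ∈ S`. -/
abbrev Occ : Type := (ℕ →₀ ℕ) × Finset ℕ

/-- The Fock space of a free boson without zero mode and a free Neveu-Schwarz fermion. It is a
`def` rather than an abbreviation so that the ring structure of its endomorphisms is not unfolded
to that of endomorphisms of finitely supported functions. -/
def Fock : Type := Occ →₀ ℂ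

noncomputable instance : AddCommGroup Fock := inferInstanceAs (AddCommGroup (Occ →₀ ℂ))

noncomputable instance : Module ℂ Fock := inferInstanceAs (Module ℂ (Occ →₀ ℂ))

/-- The basis of the Fock space indexed by occupation numbers. -/
noncomputable def ket : Module.Basis Occ ℂ Fock :=
  Module.Basis.ofRepr (LinearEquiv.refl ℂ (Occ →₀ ℂ))

/-- The vacuum vector. -/
noncomputable def vacuum : Fock := ket (0, ∅)

/-- The bosonic creation operator `a_{-i-1}`. -/
noncomputable def bosonUp (i : ℕ) : Module.End ℂ Fock :=
  ket.constr ℂ fun b => ket (b.1 + Finsupp.single i 1, b.2)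

/-- The bosonic annihilation operator dual to `bosonUp i`, normalised as the partial derivative
with respect to `a_{-i-1}`. -/
noncomputable def bosonDown (i : ℕ) : Module.End ℂ Fock :=
  ket.constr ℂ fun b => (b.1 i : ℂ) • ket (b.1 - Finsupp.single i 1, b.2)

/-- The sign picked up when a fermionic operator with index `k` is moved past the occupied fermionic
states of smaller index. -/
noncomputable def jwSign (k : ℕ) (S : Finset ℕ) : ℂ := (-1) ^ (S.filter (· < k)).card

/-- The fermionic creation operator `ψ_{-k-1/2}`. -/
noncomputable def fermionUp (k : ℕ) : Module.End ℂ Fock :=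
  ket.constr ℂ fun b => if k ∈ b.2 then 0 else jwSign k b.2 • ket (b.1, insert k b.2)

/-- The fermionic annihilation operator `ψ_{k+1/2}` with `k ≥ 0`. -/
noncomputable def fermionDown (k : ℕ) : Module.End ℂ Fock :=
  ket.constr ℂ fun b => if k ∈ b.2 then jwSign k b.2 • ket (b.1, b.2.erase k) else 0

theorem bosonUp_ket (i : ℕ) (μ : ℕ →₀ ℕ) (S : Finset ℕ) :
    bosonUp i (ket (μ, S)) = ket (μ + Finsupp.single i 1, S) :=
  ket.constr_basis ℂ _ _

theorem bosonDown_ket (i : ℕ) (μ : ℕ →₀ ℕ) (S : Finset ℕ) :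
    bosonDown i (ket (μ, S)) = (μ i : ℂ) • ket (μ - Finsupp.single i 1, S) :=
  ket.constr_basis ℂ _ _

theorem fermionUp_ket (k : ℕ) (μ : ℕ →₀ ℕ) (S : Finset ℕ) :
    fermionUp k (ket (μ, S)) = if k ∈ S then 0 else jwSign k S • ket (μ, insert k S) :=
  ket.constr_basis ℂ _ _

theorem fermionDown_ket (k : ℕ) (μ : ℕ →₀ ℕ) (S : Finset ℕ) :
    fermionDown k (ket (μ, S)) = if k ∈ S then jwSign k S • ket (μ, S.erase k) else 0 :=
  ket.constr_basis ℂ _ _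

theorem jwSign_insert {j k : ℕ} {S : Finset ℕ} (hk : k ∉ S) :
    jwSign j (insert k S) = if k < j then -jwSign j S else jwSign j S := by
  unfold jwSign
  rw [Finset.filter_insert]
  split_ifs with h
  · rw [Finset.card_insert_of_notMem (by simp [hk]), pow_succ]; ring
  · rfl

theorem jwSign_erase {j k : ℕ} {S : Finset ℕ} (hk : k ∈ S) :
    jwSign j (S.erase k) = if k < j then -jwSign j S else jwSign j S := by
  have h := jwSign_insert (j := j) (Finset.notMem_erase k S)
  rw [Finset.insert_erase hk] at h
  rw [h]; split_ifs <;> simp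

theorem jwSign_mul_self (k : ℕ) (S : Finset ℕ) : jwSign k S * jwSign k S = 1 := by
  unfold jwSign
  rw [← mul_pow]; simp

theorem jwSign_ne_zero (k : ℕ) (S : Finset ℕ) : jwSign k S ≠ 0 := by
  unfold jwSign; simp

theorem Fock.hom_ext {X Y : Module.End ℂ Fock}
    (h : ∀ μ S, X (ket (μ, S)) = Y (ket (μ, S))) : X = Y := by
  exact ket.ext fun b => h b.1 b.2

theorem bosonUp_comm (i j : ℕ) : bosonUp i * bosonUp j = bosonUp j * bosonUp i := by
  apply Fock.hom_ext; intro μ S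
  simp only [Module.End.mul_apply, bosonUp_ket, add_right_comm]

theorem bosonDown_comm (i j : ℕ) : bosonDown i * bosonDown j = bosonDown j * bosonDown i := by
  apply Fock.hom_ext; intro μ S
  simp only [Module.End.mul_apply, bosonDown_ket, map_smul, smul_smul, tsub_right_comm,
    Finsupp.tsub_apply]
  by_cases h : i = j
  · subst h; rfl
  · rw [Finsupp.single_eq_of_ne (by tauto), Finsupp.single_eq_of_ne (by tauto), mul_comm]; simp

theorem bosonDown_bosonUp (i j : ℕ) :
    bosonDown i * bosonUp j = bosonUp j * bosonDown i + (if i = j then 1 else 0) := by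
  apply Fock.hom_ext; intro μ S
  by_cases h : i = j
  · subst h
    simp only [Module.End.mul_apply, bosonDown_ket, bosonUp_ket, map_smul, if_true,
      LinearMap.add_apply, Module.End.one_apply, Finsupp.add_apply, Finsupp.single_eq_same,
      add_tsub_cancel_right, Nat.cast_add, Nat.cast_one, add_smul, one_smul]
    by_cases h0 : μ i = 0
    · simp [h0]
    · rw [tsub_add_cancel_of_le]
      intro k
      by_cases hk : k = i
      · subst hk; simp; omega
      · simp [Finsupp.single_eq_of_ne hk]
  · simp only [Module.End.mul_apply, bosonDown_ket, bosonUp_ket, map_smul, if_neg h,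
      add_zero, Finsupp.add_apply, Finsupp.single_eq_of_ne h]
    congr 2
    congr 1
    ext k
    simp only [Finsupp.tsub_apply, Finsupp.add_apply]
    by_cases hk : k = i
    · subst hk; simp [Finsupp.single_eq_of_ne h]
    · simp [Finsupp.single_eq_of_ne hk]

theorem fermionUp_anticomm (j k : ℕ) :
    fermionUp j * fermionUp k + fermionUp k * fermionUp j = 0 := by
  apply Fock.hom_ext; intro μ S
  simp only [Module.End.mul_apply, LinearMap.add_apply, fermionUp_ket, LinearMap.zero_apply]
  by_cases hj : j ∈ S <;> by_cases hk : k ∈ S <;>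
    simp only [hj, hk, if_true, if_false, map_zero, map_smul, add_zero,
      fermionUp_ket, Finset.mem_insert, or_true, smul_zero, or_false]
  rcases lt_trichotomy j k with h | h | h
  · rw [if_neg h.ne, if_neg h.ne', jwSign_insert hj, jwSign_insert hk, if_pos h,
      if_neg h.not_gt, Finset.insert_comm]
    module
  · simp [h]
  · rw [if_neg h.ne, if_neg h.ne', jwSign_insert hj, jwSign_insert hk, if_pos h,
      if_neg h.not_gt, Finset.insert_comm]
    module

theorem fermionDown_anticomm (j k : ℕ) :
    fermionDown j * fermionDown k + fermionDown k * fermionDown j = 0 := by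
  apply Fock.hom_ext; intro μ S
  simp only [Module.End.mul_apply, LinearMap.add_apply, fermionDown_ket, LinearMap.zero_apply]
  by_cases hj : j ∈ S <;> by_cases hk : k ∈ S <;>
    simp only [hj, hk, if_true, if_false, map_zero, map_smul, add_zero,
      fermionDown_ket, Finset.mem_erase, and_true, smul_zero, and_false]
  rcases lt_trichotomy j k with h | h | h
  · rw [if_pos h.ne, if_pos h.ne', jwSign_erase hj, jwSign_erase hk, if_pos h,
      if_neg h.not_gt, Finset.erase_right_comm]
    module
  · simp [h]
  · rw [if_pos h.ne, if_pos h.ne', jwSign_erase hj, jwSign_erase hk, if_pos h,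
      if_neg h.not_gt, Finset.erase_right_comm]
    module

theorem fermionDown_fermionUp (j k : ℕ) :
    fermionDown j * fermionUp k + fermionUp k * fermionDown j = if j = k then 1 else 0 := by
  apply Fock.hom_ext; intro μ S
  simp only [Module.End.mul_apply, LinearMap.add_apply, fermionDown_ket, fermionUp_ket]
  by_cases h : j = k
  · subst h
    by_cases hj : j ∈ S
    · rw [if_pos hj, if_pos hj, if_pos rfl, map_zero, zero_add, map_smul, fermionUp_ket,
        if_neg (Finset.notMem_erase j S), smul_smul, jwSign_erase hj, if_neg (lt_irrefl j),
        jwSign_mul_self, one_smul, Finset.insert_erase hj, Module.End.one_apply]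
    · rw [if_neg hj, if_neg hj, if_pos rfl, map_zero, add_zero, map_smul, fermionDown_ket,
        if_pos (Finset.mem_insert_self j S), smul_smul, jwSign_insert hj, if_neg (lt_irrefl j),
        jwSign_mul_self, one_smul, Finset.erase_insert hj, Module.End.one_apply]
  · by_cases hj : j ∈ S <;> by_cases hk : k ∈ S <;>
      simp only [hj, hk, if_true, if_false, map_zero, map_smul, add_zero, h,
        fermionDown_ket, fermionUp_ket, Finset.mem_insert, Finset.mem_erase, and_true,
        and_false, or_true, or_false, smul_zero, LinearMap.zero_apply, smul_smul, ne_eq,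
        Ne.symm h, not_false_eq_true]
    rw [jwSign_insert hk, jwSign_erase hj, Finset.erase_insert_of_ne (Ne.symm h)]
    rcases lt_or_gt_of_ne h with h' | h'
    · rw [if_neg h'.not_gt, if_pos h']; module
    · rw [if_neg h'.not_gt, if_pos h']; module

theorem bosonUp_fermionUp (i k : ℕ) : bosonUp i * fermionUp k = fermionUp k * bosonUp i := by
  apply Fock.hom_ext; intro μ S
  simp only [Module.End.mul_apply, fermionUp_ket, bosonUp_ket]
  split_ifs <;> simp only [map_zero, map_smul, bosonUp_ket]

theorem bosonUp_fermionDown (i k : ℕ) :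
    bosonUp i * fermionDown k = fermionDown k * bosonUp i := by
  apply Fock.hom_ext; intro μ S
  simp only [Module.End.mul_apply, fermionDown_ket, bosonUp_ket]
  split_ifs <;> simp only [map_zero, map_smul, bosonUp_ket]

theorem bosonDown_fermionUp (i k : ℕ) :
    bosonDown i * fermionUp k = fermionUp k * bosonDown i := by
  apply Fock.hom_ext; intro μ S
  simp only [Module.End.mul_apply, fermionUp_ket, bosonDown_ket, map_smul]
  split_ifs <;> simp only [map_smul, bosonDown_ket, smul_zero, map_zero, smul_smul, mul_comm]

theorem bosonDown_fermionDown (i k : ℕ) :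
    bosonDown i * fermionDown k = fermionDown k * bosonDown i := by
  apply Fock.hom_ext; intro μ S
  simp only [Module.End.mul_apply, fermionDown_ket, bosonDown_ket, map_smul]
  split_ifs <;> simp only [map_smul, bosonDown_ket, smul_zero, map_zero, smul_smul, mul_comm]

/-- The bosonic mode `a_n`, with `a_0 = 0` and `[a_m, a_n] = m δ_{m+n,0}`. -/
noncomputable def aMode : ℤ → Module.End ℂ Fock
  | Int.ofNat 0 => 0
  | Int.ofNat (i + 1) => ((i : ℂ) + 1) • bosonDown i
  | Int.negSucc i => bosonUp i

/-- The fermionic mode `ψ_{k+1/2}`, half-integers being encoded as for `Gen.G`. Since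
`Int.negSucc k` is `-k - 1`, it encodes the half-integer `-k - 1/2`. -/
noncomputable def psiMode : ℤ → Module.End ℂ Fock
  | Int.ofNat k => fermionDown k
  | Int.negSucc k => fermionUp k

theorem aMode_zero : aMode 0 = 0 := rfl

theorem aMode_comm (m n : ℤ) :
    aMode m * aMode n = aMode n * aMode m + (if m + n = 0 then (m : ℂ) else 0) • 1 := by
  rcases m with (_ | i) | i <;> rcases n with (_ | j) | j
  · simp [aMode]
  · simp only [aMode, zero_mul, mul_zero, zero_add]; rw [if_neg (by simp; omega)]; simp
  · simp only [aMode, zero_mul, mul_zero, zero_add]; rw [if_neg (by simp)]; simp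
  · simp only [aMode, zero_mul, mul_zero, zero_add]; rw [if_neg (by simp; omega)]; simp
  · simp only [aMode]
    rw [if_neg (by simp; omega), zero_smul, add_zero, smul_mul_smul_comm, smul_mul_smul_comm,
      bosonDown_comm, mul_comm (_ + _ : ℂ)]
  · simp only [aMode]
    rw [smul_mul_assoc, bosonDown_bosonUp, mul_smul_comm, smul_add]
    congr 1
    by_cases h : i = j
    · subst h
      rw [if_pos rfl, if_pos (by rw [Int.negSucc_eq]; simp)]; simp
    · rw [if_neg h, if_neg (by rw [Int.negSucc_eq]; simp; omega)]; simp
  · simp only [aMode, zero_mul, mul_zero, zero_add]; rw [if_neg (by simp)]; simp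
  · simp only [aMode]
    rw [smul_mul_assoc, bosonDown_bosonUp, mul_smul_comm, smul_add, add_assoc]
    symm
    convert add_zero _ using 2
    by_cases h : i = j
    · subst h
      rw [if_pos rfl, if_pos (by rw [Int.negSucc_eq]; simp), Int.negSucc_eq, ← add_smul]
      simp
    · rw [if_neg (Ne.symm h), if_neg (by rw [Int.negSucc_eq]; simp; omega)]; simp
  · simp only [aMode]
    rw [if_neg (by simp [Int.negSucc_eq]; omega), bosonUp_comm]; simp

theorem psiMode_anticomm (j k : ℤ) :
    psiMode j * psiMode k + psiMode k * psiMode j =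
      (if j + k + 1 = 0 then (1 : ℂ) else 0) • 1 := by
  rcases j with j | j <;> rcases k with k | k <;> simp only [psiMode]
  · rw [fermionDown_anticomm, if_neg (by simp; omega), zero_smul]
  · rw [fermionDown_fermionUp]
    by_cases h : j = k
    · subst h; rw [if_pos rfl, if_pos (by simp [Int.negSucc_eq]), one_smul]
    · rw [if_neg h, if_neg (by simp [Int.negSucc_eq]; omega), zero_smul]
  · rw [add_comm, fermionDown_fermionUp]
    by_cases h : k = j
    · subst h; rw [if_pos rfl, if_pos (by simp [Int.negSucc_eq]), one_smul]
    · rw [if_neg h, if_neg (by simp [Int.negSucc_eq]; omega), zero_smul]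
  · rw [fermionUp_anticomm, if_neg (by simp [Int.negSucc_eq]; omega), zero_smul]

theorem aMode_psiMode (n k : ℤ) : aMode n * psiMode k = psiMode k * aMode n := by
  rcases n with (_ | i) | i <;> rcases k with k | k <;>
    simp [aMode, psiMode, bosonUp_fermionUp, bosonUp_fermionDown, bosonDown_fermionUp,
      bosonDown_fermionDown]

theorem aMode_vacuum {n : ℤ} (hn : 0 ≤ n) : aMode n vacuum = 0 := by
  rcases n with (_ | i) | i
  · simp [aMode]
  · simp [aMode, vacuum, bosonDown_ket]
  · simp at hn

theorem psiMode_vacuum {k : ℤ} (hk : 0 ≤ k) : psiMode k vacuum = 0 := by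
  rcases k with k | k
  · simp [psiMode, vacuum, fermionDown_ket]
  · simp at hk

theorem Occ.induction {P : Occ → Prop} (vac : P (0, ∅))
    (boson : ∀ i μ S, P (μ, S) → P (μ + Finsupp.single i 1, S))
    (fermion : ∀ k μ S, k ∉ S → P (μ, S) → P (μ, insert k S)) (b : Occ) : P b := by
  obtain ⟨μ, S⟩ := b
  induction μ using Finsupp.induction with
  | zero =>
    induction S using Finset.induction_on with
    | empty => exact vac
    | insert k S hk ih => exact fermion k 0 S hk ih
  | single_add i n μ _ _ ih =>
    induction n with
    | zero => simpa using ih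
    | succ n ihn =>
      by_cases hn : n = 0
      · subst hn
        rw [add_comm]
        exact boson i μ S ih
      · have := boson i _ _ (ihn hn)
        rwa [add_right_comm, ← Finsupp.single_add] at this

/-- The Fock space is generated from the vacuum by creation operators and linear combinations. -/
theorem Fock.induction {P : Fock → Prop} (vac : P vacuum) (zero : P 0)
    (add : ∀ v w, P v → P w → P (v + w)) (smul : ∀ (c : ℂ) v, P v → P (c • v))
    (boson : ∀ i v, P v → P (bosonUp i v)) (fermion : ∀ k v, P v → P (fermionUp k v)) (v : Fock) :
    P v := by
  have h : ∀ b : Occ, P (ket b) := by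
    intro b
    induction b using Occ.induction with
    | vac => exact vac
    | boson i μ S ih =>
      have := boson i _ ih
      rwa [bosonUp_ket] at this
    | fermion k μ S hk ih =>
      have := smul (jwSign k S) _ (fermion k _ ih)
      rwa [fermionUp_ket, if_neg hk, smul_smul, jwSign_mul_self, one_smul] at this
  rw [← ket.linearCombination_repr v, Finsupp.linearCombination_apply, Finsupp.sum]
  exact Finset.sum_induction _ P add zero fun b _ => smul _ _ (h b)

/-- On a fixed vector all modes of large index vanish, so that sums over all modes are finite. -/
theorem modes_eventually_zero (v : Fock) :
    ∃ K : ℤ, ∀ n : ℤ, K ≤ n → aMode n v = 0 ∧ psiMode n v = 0 := by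
  induction v using Fock.induction with
  | vac => exact ⟨0, fun n hn => ⟨aMode_vacuum hn, psiMode_vacuum hn⟩⟩
  | zero => exact ⟨0, fun n _ => by simp⟩
  | add v w hv hw =>
    obtain ⟨K, hK⟩ := hv
    obtain ⟨K', hK'⟩ := hw
    refine ⟨max K K', fun n hn => ?_⟩
    obtain ⟨h1, h2⟩ := hK n (le_trans (le_max_left _ _) hn)
    obtain ⟨h3, h4⟩ := hK' n (le_trans (le_max_right _ _) hn)
    simp [h1, h2, h3, h4]
  | smul c v hv =>
    obtain ⟨K, hK⟩ := hv
    exact ⟨K, fun n hn => by simp [hK n hn]⟩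
  | boson i v hv =>
    obtain ⟨K, hK⟩ := hv
    refine ⟨max K (i + 2), fun n hn => ?_⟩
    obtain ⟨h1, h2⟩ := hK n (le_trans (le_max_left _ _) hn)
    have hn' := le_trans (le_max_right _ _) hn
    have e1 := LinearMap.congr_fun (aMode_comm n (Int.negSucc i)) v
    have e2 := LinearMap.congr_fun (aMode_psiMode (Int.negSucc i) n) v
    rw [if_neg (by rw [Int.negSucc_eq]; omega)] at e1
    simp only [Module.End.mul_apply, h1, h2, map_zero, zero_smul, add_zero] at e1 e2
    exact ⟨e1, e2.symm⟩
  | fermion k v hv =>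
    obtain ⟨K, hK⟩ := hv
    refine ⟨max K (k + 2), fun n hn => ?_⟩
    obtain ⟨h1, h2⟩ := hK n (le_trans (le_max_left _ _) hn)
    have hn' := le_trans (le_max_right _ _) hn
    have e1 := LinearMap.congr_fun (psiMode_anticomm n (Int.negSucc k)) v
    have e2 := LinearMap.congr_fun (aMode_psiMode n (Int.negSucc k)) v
    rw [if_neg (by rw [Int.negSucc_eq]; omega)] at e1
    simp only [Module.End.mul_apply, LinearMap.add_apply, h1, h2, map_zero, zero_smul, add_zero,
      LinearMap.zero_apply] at e1 e2
    exact ⟨e2, e1⟩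

theorem finite_support_modes (j d : ℤ) (f : ℤ → ℂ) (v : Fock) :
    (Function.support fun n : ℤ => f n • aMode (n + d) (psiMode (j - n) v)).Finite := by
  obtain ⟨K, hK⟩ := modes_eventually_zero v
  refine (Set.finite_Icc (j - K) (K - d)).subset fun n hn => ?_
  rw [Function.mem_support] at hn
  by_contra h
  apply hn
  rw [Set.mem_Icc, not_and_or, not_le, not_le] at h
  rcases h with h | h
  · rw [(hK (j - n) (by omega)).2, map_zero, smul_zero]
  · have e := LinearMap.congr_fun (aMode_psiMode (n + d) (j - n)) v
    simp only [Module.End.mul_apply] at e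
    rw [e, (hK (n + d) (by omega)).1, map_zero, smul_zero]

theorem finite_support_gOp (j : ℤ) (v : Fock) :
    (Function.support fun n : ℤ => aMode n (psiMode (j - n) v)).Finite := by
  simpa using finite_support_modes j 0 1 v

/-! ### The Neveu-Schwarz operators on the Fock space -/

/-- The operator `G_r = ∑ a_n ψ_{r - n} + κ (r + 1/2) ψ_r` with `r = j + 1/2`. -/
noncomputable def gOp (κ : ℂ) (j : ℤ) : Module.End ℂ Fock where
  toFun v := (∑ᶠ n : ℤ, aMode n (psiMode (j - n) v)) + (κ * (j + 1)) • psiMode j v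
  map_add' v w := by
    simp only [map_add, smul_add]
    rw [finsum_add_distrib (finite_support_gOp j v) (finite_support_gOp j w)]
    abel
  map_smul' c v := by
    simp only [map_smul, RingHom.id_apply, smul_add]
    rw [smul_finsum, smul_comm c]

theorem gOp_apply (κ : ℂ) (j : ℤ) (v : Fock) :
    gOp κ j v = (∑ᶠ n : ℤ, aMode n (psiMode (j - n) v)) + (κ * (j + 1)) • psiMode j v := rfl

theorem gOp_aMode (κ : ℂ) (j n : ℤ) :
    gOp κ j * aMode n = aMode n * gOp κ j - (n : ℂ) • psiMode (j + n) := by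
  refine LinearMap.ext fun v => ?_
  simp only [Module.End.mul_apply, LinearMap.sub_apply, LinearMap.smul_apply]
  have h : ∀ m : ℤ, aMode m (psiMode (j - m) (aMode n v)) =
      aMode n (aMode m (psiMode (j - m) v)) +
        (if m + n = 0 then (m : ℂ) else 0) • psiMode (j - m) v := by
    intro m
    have e1 := LinearMap.congr_fun (aMode_psiMode n (j - m)) v
    have e2 := LinearMap.congr_fun (aMode_comm m n) (psiMode (j - m) v)
    simp only [Module.End.mul_apply, LinearMap.add_apply, LinearMap.smul_apply,
      Module.End.one_apply] at e1 e2
    rw [← e1, e2]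
  have hδ : ∑ᶠ m : ℤ, (if m + n = 0 then (m : ℂ) else 0) • psiMode (j - m) v =
      (-n : ℂ) • psiMode (j + n) v := by
    rw [finsum_eq_single _ (-n), if_pos (by ring), sub_neg_eq_add]
    · push_cast; rfl
    · intro m hm; rw [if_neg (by omega), zero_smul]
  have e3 := LinearMap.congr_fun (aMode_psiMode n j) v
  simp only [Module.End.mul_apply] at e3
  rw [gOp_apply, gOp_apply, finsum_congr h, finsum_add_distrib,
    ← map_finsum (aMode n) (finite_support_gOp j v), hδ, map_add, map_smul, e3]
  · module
  · exact (finite_support_gOp j v).subset fun m hm hm' => hm (by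
      have : aMode m (psiMode (j - m) v) = 0 := hm'
      simp [this])
  · refine (Set.finite_singleton (-n)).subset fun m hm => ?_
    by_contra hm'
    exact hm (by
      have : m + n ≠ 0 := fun h => hm' (by simp; omega)
      simp [this])

theorem gOp_psiMode (κ : ℂ) (j k : ℤ) :
    gOp κ j * psiMode k = -(psiMode k * gOp κ j) + aMode (j + k + 1) +
      (if j + k + 1 = 0 then κ * (j + 1) else 0) • 1 := by
  refine LinearMap.ext fun v => ?_
  simp only [Module.End.mul_apply, LinearMap.neg_apply, LinearMap.add_apply, LinearMap.smul_apply,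
    Module.End.one_apply]
  have h : ∀ m : ℤ, aMode m (psiMode (j - m) (psiMode k v)) =
      -(psiMode k (aMode m (psiMode (j - m) v))) +
        (if j - m + k + 1 = 0 then (1 : ℂ) else 0) • aMode m v := by
    intro m
    have e1 := LinearMap.congr_fun (psiMode_anticomm (j - m) k) v
    have e2 := LinearMap.congr_fun (aMode_psiMode m k) (psiMode (j - m) v)
    simp only [Module.End.mul_apply, LinearMap.add_apply, LinearMap.smul_apply,
      Module.End.one_apply] at e1 e2
    rw [← e2, eq_sub_of_add_eq e1, map_sub, map_smul]; abel
  have hδ : ∑ᶠ m : ℤ, (if j - m + k + 1 = 0 then (1 : ℂ) else 0) • aMode m v =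
      aMode (j + k + 1) v := by
    rw [finsum_eq_single _ (j + k + 1), if_pos (by ring), one_smul]
    intro m hm; rw [if_neg (by omega), zero_smul]
  have e3 := LinearMap.congr_fun (psiMode_anticomm j k) v
  simp only [Module.End.mul_apply, LinearMap.add_apply, LinearMap.smul_apply,
      Module.End.one_apply] at e3
  rw [gOp_apply, gOp_apply, finsum_congr h, finsum_add_distrib, finsum_neg_distrib,
    ← map_finsum (psiMode k) (finite_support_gOp j v),
    hδ, map_add, map_smul, eq_sub_of_add_eq e3]
  · split_ifs <;> module
  · exact (finite_support_gOp j v).subset fun m hm hm' => hm (by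
      have : aMode m (psiMode (j - m) v) = 0 := hm'
      simp [this])
  · refine (Set.finite_singleton (j + k + 1)).subset fun m hm => ?_
    by_contra hm'
    exact hm (by
      have : j - m + k + 1 ≠ 0 := fun h => hm' (by simp; omega)
      simp [this])

/-- The anticommutator of the odd operators with indices `i` and `j`. -/
noncomputable def gAnti (κ : ℂ) (i j : ℤ) : Module.End ℂ Fock :=
  gOp κ i * gOp κ j + gOp κ j * gOp κ i

theorem gAnti_psiMode (κ : ℂ) (i j k : ℤ) :
    gAnti κ i j * psiMode k =
      psiMode k * gAnti κ i j - ((i : ℂ) + j + 2 * k + 2) • psiMode (i + j + 1 + k) := by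
  have h1 : ∀ i j : ℤ, gOp κ i * gOp κ j * psiMode k = psiMode k * (gOp κ i * gOp κ j)
      - aMode (i + k + 1) * gOp κ j + aMode (j + k + 1) * gOp κ i
      - ((j : ℂ) + k + 1) • psiMode (i + j + 1 + k)
      - (if i + k + 1 = 0 then κ * (i + 1) else 0) • gOp κ j
      + (if j + k + 1 = 0 then κ * (j + 1) else 0) • gOp κ i := by
    intro i j
    rw [mul_assoc, gOp_psiMode, mul_add, mul_add, mul_neg, ← mul_assoc, gOp_psiMode, gOp_aMode,
      show i + (j + k + 1) = i + j + 1 + k by ring, mul_smul_comm, mul_one, add_mul, add_mul,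
      smul_mul_assoc, one_mul, neg_mul, mul_assoc]
    push_cast
    module
  unfold gAnti
  rw [add_mul, h1, h1, show j + i + 1 + k = i + j + 1 + k by ring,
    mul_add (psiMode k)]
  module

theorem gAnti_aMode (κ : ℂ) (i j n : ℤ) :
    gAnti κ i j * aMode n =
      aMode n * gAnti κ i j - (2 * n : ℂ) • aMode (i + j + 1 + n)
        - (if i + j + 1 + n = 0 then (n : ℂ) * κ * (i + j + 2) else 0) • 1 := by
  have h1 : ∀ i j : ℤ, gOp κ i * gOp κ j * aMode n = aMode n * (gOp κ i * gOp κ j)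
      - (n : ℂ) • (psiMode (i + n) * gOp κ j) + (n : ℂ) • (psiMode (j + n) * gOp κ i)
      - (n : ℂ) • aMode (i + j + 1 + n)
      - ((n : ℂ) * if i + j + 1 + n = 0 then κ * (i + 1) else 0) • 1 := by
    intro i j
    rw [mul_assoc, gOp_aMode, mul_sub, mul_smul_comm, ← mul_assoc, gOp_aMode, gOp_psiMode,
      show i + (j + n) + 1 = i + j + 1 + n by ring, sub_mul, smul_mul_assoc, mul_assoc]
    module
  unfold gAnti
  rw [add_mul, h1, h1, show j + i + 1 + n = i + j + 1 + n by ring,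
    mul_add (aMode n)]
  split_ifs <;> module

/-- The operator `L_m`, defined as half the anticommutator of `G_{-1/2}` and `G_{m+1/2}`. -/
noncomputable def lOp (κ : ℂ) (m : ℤ) : Module.End ℂ Fock := (1 / 2 : ℂ) • gAnti κ (-1) m

theorem lOp_psiMode (κ : ℂ) (m k : ℤ) :
    lOp κ m * psiMode k =
      psiMode k * lOp κ m - (((m : ℂ) + 2 * k + 1) / 2) • psiMode (m + k) := by
  unfold lOp
  rw [smul_mul_assoc, gAnti_psiMode, mul_smul_comm, show -1 + m + 1 + k = m + k by ring]
  push_cast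
  module

theorem lOp_aMode (κ : ℂ) (m n : ℤ) :
    lOp κ m * aMode n = aMode n * lOp κ m - (n : ℂ) • aMode (m + n)
        - (if m + n = 0 then (n : ℂ) * κ * (m + 1) / 2 else 0) • 1 := by
  unfold lOp
  rw [smul_mul_assoc, gAnti_aMode, mul_smul_comm, show -1 + m + 1 + n = m + n by ring]
  push_cast
  split_ifs <;> module

/-- The relation `[L_m, G_s] = (m/2 - s) G_{m+s}` on the Fock space. -/
theorem lOp_gOp (κ : ℂ) (m k : ℤ) :
    lOp κ m * gOp κ k - gOp κ k * lOp κ m = ((m : ℂ) / 2 - (k + 1 / 2)) • gOp κ (m + k) := by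
  refine LinearMap.ext fun v => ?_
  simp only [Module.End.mul_apply, LinearMap.sub_apply, LinearMap.smul_apply]
  have h : ∀ n : ℤ, lOp κ m (aMode n (psiMode (k - n) v)) =
      aMode n (psiMode (k - n) (lOp κ m v)) -
        (((m : ℂ) + 2 * (k - n) + 1) / 2) • aMode (n + 0) (psiMode (m + k - n) v)
        - (n : ℂ) • aMode (n + m) (psiMode (k - n) v)
        - (if m + n = 0 then (n : ℂ) * κ * (m + 1) / 2 else 0) • psiMode (k - n) v := by
    intro n
    have e1 := LinearMap.congr_fun (lOp_aMode κ m n) (psiMode (k - n) v)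
    have e2 := LinearMap.congr_fun (lOp_psiMode κ m (k - n)) v
    simp only [Module.End.mul_apply, LinearMap.smul_apply, Module.End.one_apply,
      LinearMap.sub_apply] at e1 e2
    rw [e1, e2, map_sub, map_smul, add_zero, show m + (k - n) = m + k - n by ring, add_comm n m]
    push_cast
    rfl
  have e3 := LinearMap.congr_fun (lOp_psiMode κ m k) v
  simp only [Module.End.mul_apply, LinearMap.smul_apply, LinearMap.sub_apply] at e3
  -- the part of `[L_m, G_s]` coming from `[L_m, a_n]` is brought to the index `n - m`
  have hs : (∑ᶠ n : ℤ, (n : ℂ) • aMode (n + m) (psiMode (k - n) v)) =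
      ∑ᶠ n : ℤ, ((n : ℂ) - m) • aMode (n + 0) (psiMode (m + k - n) v) := by
    rw [← finsum_comp_equiv (Equiv.subRight m)]
    apply finsum_congr
    intro n
    simp only [Equiv.subRight_apply, sub_add_cancel, add_zero]
    rw [show k - (n - m) = m + k - n by ring]
    push_cast
    rfl
  have hlast : (Function.support fun n : ℤ =>
      (if m + n = 0 then (n : ℂ) * κ * (m + 1) / 2 else 0) • psiMode (k - n) v).Finite := by
    refine (Set.finite_singleton (-m)).subset fun n hn => ?_
    by_contra hn'
    exact hn (by
      have : m + n ≠ 0 := fun h => hn' (by simp; omega)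
      simp [this])
  have hδ : ∑ᶠ n : ℤ, (if m + n = 0 then (n : ℂ) * κ * (m + 1) / 2 else 0) • psiMode (k - n) v =
      (-m * κ * (m + 1) / 2 : ℂ) • psiMode (m + k) v := by
    rw [finsum_eq_single _ (-m), if_pos (by ring), sub_neg_eq_add, add_comm k m]
    · push_cast; rfl
    · intro n hn; rw [if_neg (by omega), zero_smul]
  have f1 := finite_support_gOp k (lOp κ m v)
  have f2 := finite_support_modes (m + k) 0 (fun n : ℤ => ((m : ℂ) + 2 * (k - n) + 1) / 2) v
  have f3 := finite_support_modes k m (fun n : ℤ => (n : ℂ)) v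
  have f4 := finite_support_modes (m + k) 0 (fun n : ℤ => (n : ℂ) - m) v
  rw [gOp_apply κ k v, gOp_apply κ k (lOp κ m v), gOp_apply κ (m + k), map_add, map_smul,
    map_finsum _ (finite_support_gOp k v), finsum_congr h,
    finsum_sub_distrib _ hlast, finsum_sub_distrib _ f3,
    finsum_sub_distrib f1 f2, hs, hδ, e3, smul_add,
    smul_finsum]
  · have key : (∑ᶠ n : ℤ, ((m : ℂ) / 2 - (k + 1 / 2)) • aMode n (psiMode (m + k - n) v)) =
        -(∑ᶠ n : ℤ, (((m : ℂ) + 2 * (k - n) + 1) / 2) • aMode (n + 0) (psiMode (m + k - n) v))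
        - ∑ᶠ n : ℤ, ((n : ℂ) - m) • aMode (n + 0) (psiMode (m + k - n) v) := by
      rw [← finsum_neg_distrib, ← finsum_sub_distrib _ f4]
      · apply finsum_congr
        intro n
        rw [add_zero]
        module
      · exact f2.subset fun n hn hn' => hn (by
          simp only at hn' ⊢
          rw [hn', neg_zero])
    rw [key]
    push_cast
    module
  · exact (f1.union f2).subset (Function.support_sub _ _)
  · exact ((f1.union f2).union f3).subset ((Function.support_sub _ _).trans
      (Set.union_subset_union_left _ (Function.support_sub _ _)))

/-- An operator commuting with all modes commutes with all `G_r`. -/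
theorem commute_gOp {X : Module.End ℂ Fock} (ha : ∀ n, X * aMode n = aMode n * X)
    (hψ : ∀ k, X * psiMode k = psiMode k * X) (κ : ℂ) (j : ℤ) : X * gOp κ j = gOp κ j * X := by
  refine LinearMap.ext fun v => ?_
  simp only [Module.End.mul_apply, gOp_apply, map_add, map_smul]
  have ha' : ∀ n v, X (aMode n v) = aMode n (X v) := fun n => LinearMap.congr_fun (ha n)
  have hψ' : ∀ k v, X (psiMode k v) = psiMode k (X v) := fun k => LinearMap.congr_fun (hψ k)
  rw [map_finsum X (finite_support_gOp j v), hψ']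
  simp only [ha', hψ']

theorem gOp_vacuum (κ : ℂ) {j : ℤ} (hj : -1 ≤ j) : gOp κ j vacuum = 0 := by
  rw [gOp_apply, finsum_eq_zero_of_forall_eq_zero]
  · rcases hj.eq_or_lt with rfl | h
    · simp
    · rw [psiMode_vacuum (by omega), smul_zero, add_zero]
  · intro n
    rcases le_or_gt 0 n with h | h
    · have e := LinearMap.congr_fun (aMode_psiMode n (j - n)) vacuum
      simp only [Module.End.mul_apply] at e
      rw [e, aMode_vacuum h, map_zero]
    · rw [psiMode_vacuum (by omega), map_zero]

/-- The value of `G_r G_{-r}` on the vacuum, which fixes the central charge. -/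
theorem gOp_gOp_vacuum (κ : ℂ) {j : ℤ} (hj : 0 ≤ j) :
    gOp κ j (gOp κ (-1 - j) vacuum) = ((j : ℂ) * (j + 1) * (1 / 2 - κ ^ 2)) • vacuum := by
  have hψ : ∀ k : ℤ, gOp κ j (psiMode k vacuum) =
      aMode (j + k + 1) vacuum + (if j + k + 1 = 0 then κ * (j + 1) else 0) • vacuum := by
    intro k
    have e := LinearMap.congr_fun (gOp_psiMode κ j k) vacuum
    simp only [Module.End.mul_apply, LinearMap.add_apply, LinearMap.neg_apply,
      LinearMap.smul_apply, Module.End.one_apply] at e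
    rw [e, gOp_vacuum κ (by omega), map_zero, neg_zero, zero_add]
  have hterm : ∀ n : ℤ, gOp κ j (aMode n (psiMode (-1 - j - n) vacuum)) =
      (if n ∈ Finset.Icc (-j) (-1) then (-n : ℂ) else 0) • vacuum := by
    intro n
    have e := LinearMap.congr_fun (gOp_aMode κ j n) (psiMode (-1 - j - n) vacuum)
    have hA : aMode n (aMode (-n) vacuum) = (if 0 ≤ n then (n : ℂ) else 0) • vacuum := by
      split_ifs with h
      · have e1 := LinearMap.congr_fun (aMode_comm n (-n)) vacuum
        rw [if_pos (by ring)] at e1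
        simpa [aMode_vacuum h] using e1
      · rw [aMode_vacuum (by omega), map_zero, zero_smul]
    have hB : psiMode (j + n) (psiMode (-1 - j - n) vacuum) =
        (if 0 ≤ j + n then (1 : ℂ) else 0) • vacuum := by
      split_ifs with h
      · have e1 := LinearMap.congr_fun (psiMode_anticomm (j + n) (-1 - j - n)) vacuum
        rw [if_pos (by ring)] at e1
        simpa [psiMode_vacuum h] using e1
      · rw [psiMode_vacuum (by omega), map_zero, zero_smul]
    have hC : (if -n = 0 then κ * (j + 1) else 0) • aMode n vacuum = 0 := by
      split_ifs with h
      · rw [aMode_vacuum (by omega), smul_zero]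
      · rw [zero_smul]
    simp only [Module.End.mul_apply, LinearMap.sub_apply, LinearMap.smul_apply] at e
    rw [e, hψ, show j + (-1 - j - n) + 1 = -n by ring, map_add, map_smul, hA, hB, hC, add_zero,
      smul_smul, ← sub_smul]
    congr 1
    simp only [Finset.mem_Icc]
    split_ifs <;> first | omega | simp
  have hsum : ∀ m : ℕ, ∑ n ∈ Finset.Icc (-(m : ℤ)) (-1), (-n : ℂ) = (m : ℂ) * (m + 1) / 2 := by
    intro m
    induction m with
    | zero => simp
    | succ m ih =>
      rw [show Finset.Icc (-((m + 1 : ℕ) : ℤ)) (-1) =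
        insert (-((m + 1 : ℕ) : ℤ)) (Finset.Icc (-(m : ℤ)) (-1)) from ?_, Finset.sum_insert, ih]
      · push_cast; ring
      · simp
      · ext n; simp only [Finset.mem_Icc, Finset.mem_insert]; push_cast; omega
  rw [gOp_apply κ (-1 - j), map_add, map_smul,
    map_finsum (gOp κ j) (finite_support_gOp (-1 - j) vacuum), finsum_congr hterm, hψ,
    show j + (-1 - j) + 1 = 0 by ring, if_pos rfl, aMode_zero]
  rw [finsum_eq_sum_of_support_subset _ (s := Finset.Icc (-j) (-1))]
  · lift j to ℕ using hj
    rw [Finset.sum_congr rfl fun n hn => by rw [if_pos hn], ← Finset.sum_smul, hsum]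
    push_cast
    simp only [LinearMap.zero_apply, zero_add]
    module
  · intro n hn
    by_contra h
    rw [Finset.mem_coe] at h
    exact hn (by simp only [if_neg h, zero_smul])

theorem lOp_vacuum (κ : ℂ) {m : ℤ} (hm : -1 ≤ m) : lOp κ m vacuum = 0 := by
  simp [lOp, gAnti, gOp_vacuum κ hm, gOp_vacuum κ le_rfl]

theorem gAnti_comm (κ : ℂ) (i j : ℤ) : gAnti κ i j = gAnti κ j i := add_comm _ _

/-- The relation for `{G_r, G_s}`. The difference `X` of the two sides without the central term
commutes with all modes, because the commutators of `{G_r, G_s}` with the modes depend only on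
`r + s`. So `X` commutes with `L_0`; but it is homogeneous of degree `r + s`, hence zero if
`r + s ≠ 0`. If `r + s = 0` it is the scalar by which it acts on the vacuum. -/
theorem gAnti_eq (κ : ℂ) (i j : ℤ) :
    gAnti κ i j = (2 : ℂ) • lOp κ (i + j + 1) +
      (if i + j + 1 = 0 then (i : ℂ) * (i + 1) * (1 / 2 - κ ^ 2) else 0) • 1 := by
  -- both sides are symmetric, and of two opposite half-integers one is positive
  wlog hi : i + j + 1 = 0 → 0 ≤ i generalizing i j
  · push Not at hi
    have h := this j i (fun h => by omega)
    rw [gAnti_comm, h, add_comm j i]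
    obtain rfl : j = -1 - i := by omega
    congr 2
    split_ifs
    · push_cast; ring
    · rfl
  rw [← sub_eq_iff_eq_add']
  set m := i + j + 1 with hm
  have ha : ∀ n, (gAnti κ i j - (2 : ℂ) • lOp κ m) * aMode n =
      aMode n * (gAnti κ i j - (2 : ℂ) • lOp κ m) := by
    intro n
    rw [sub_mul, gAnti_aMode, smul_mul_assoc, lOp_aMode, mul_sub, mul_smul_comm, ← hm]
    have : (m : ℂ) = i + j + 1 := by rw [hm]; push_cast; ring
    rw [this]
    split_ifs <;> module
  have hψ : ∀ k, (gAnti κ i j - (2 : ℂ) • lOp κ m) * psiMode k =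
      psiMode k * (gAnti κ i j - (2 : ℂ) • lOp κ m) := by
    intro n
    rw [sub_mul, gAnti_psiMode, smul_mul_assoc, lOp_psiMode, mul_sub, mul_smul_comm, ← hm]
    have : (m : ℂ) = i + j + 1 := by rw [hm]; push_cast; ring
    rw [this]
    module
  set X := gAnti κ i j - (2 : ℂ) • lOp κ m with hX
  by_cases h0 : m = 0
  · rw [if_pos h0]
    have hvac : X vacuum = ((i : ℂ) * (i + 1) * (1 / 2 - κ ^ 2)) • vacuum := by
      rw [hX, LinearMap.sub_apply, LinearMap.smul_apply, lOp_vacuum κ (by omega), smul_zero,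
        sub_zero, gAnti, LinearMap.add_apply, Module.End.mul_apply, Module.End.mul_apply,
        gOp_vacuum κ (j := i) (by have := hi h0; omega), map_zero, add_zero,
        show j = -1 - i by omega, gOp_gOp_vacuum κ (hi h0)]
    refine LinearMap.ext fun v => ?_
    rw [LinearMap.smul_apply, Module.End.one_apply]
    induction v using Fock.induction with
    | vac => exact hvac
    | zero => simp
    | add v w hv hw => rw [map_add, hv, hw, smul_add]
    | smul c v hv => rw [map_smul, hv, smul_comm]
    | boson n v hv =>
      have e := LinearMap.congr_fun (ha (Int.negSucc n)) v
      simp only [Module.End.mul_apply, hv, map_smul] at e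
      exact e
    | fermion k v hv =>
      have e := LinearMap.congr_fun (hψ (Int.negSucc k)) v
      simp only [Module.End.mul_apply, hv, map_smul] at e
      exact e
  · rw [if_neg h0, zero_smul]
    -- `[L_0, X]` is both `0` and `-m X`
    have hG := commute_gOp ha hψ κ
    have c1 : X * lOp κ 0 = lOp κ 0 * X := by
      rw [lOp, gAnti, mul_smul_comm, smul_mul_assoc, mul_add, add_mul, ← mul_assoc, hG,
        mul_assoc, hG, ← mul_assoc X, hG, mul_assoc _ X, hG]
      simp only [mul_assoc]
    have c2 : ∀ i j : ℤ, lOp κ 0 * gAnti κ i j - gAnti κ i j * lOp κ 0 =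
        (-((i : ℂ) + j + 1)) • gAnti κ i j := by
      intro i j
      have e : ∀ k : ℤ, lOp κ 0 * gOp κ k = gOp κ k * lOp κ 0 - ((k : ℂ) + 1 / 2) • gOp κ k := by
        intro k
        have := lOp_gOp κ 0 k
        rw [zero_add] at this
        rw [sub_eq_iff_eq_add.mp this]
        push_cast
        module
      have e2 : ∀ i j : ℤ, lOp κ 0 * (gOp κ i * gOp κ j) = gOp κ i * gOp κ j * lOp κ 0
          - ((i : ℂ) + j + 1) • (gOp κ i * gOp κ j) := by
        intro i j
        rw [← mul_assoc, e, sub_mul, mul_assoc, e, mul_sub, smul_mul_assoc, mul_smul_comm,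
          mul_assoc]
        module
      rw [gAnti, mul_add, add_mul, e2, e2]
      module
    have c3 : lOp κ 0 * X - X * lOp κ 0 = (-(m : ℂ)) • X := by
      have : (m : ℂ) = i + j + 1 := by rw [hm]; push_cast; ring
      have e1 := c2 i j
      have e2 := c2 (-1) m
      rw [hX, show lOp κ m = (1 / 2 : ℂ) • gAnti κ (-1) m from rfl, mul_sub, sub_mul,
        mul_smul_comm, smul_mul_assoc, mul_smul_comm, smul_mul_assoc,
        sub_eq_iff_eq_add.mp e1, sub_eq_iff_eq_add.mp e2, this]
      push_cast
      module
    rw [c1, sub_self] at c3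
    have : (-(m : ℂ)) ≠ 0 := by
      rw [neg_ne_zero]; exact_mod_cast h0
    exact (smul_eq_zero.mp c3.symm).resolve_left this

/-- The Virasoro relation, a consequence of `lOp_gOp` and `gAnti_eq` because `L_n` is an
anticommutator of odd operators. -/
theorem lOp_lOp (κ : ℂ) (m n : ℤ) :
    lOp κ m * lOp κ n - lOp κ n * lOp κ m = ((m : ℂ) - n) • lOp κ (m + n) +
      (if m + n = 0 then ((m : ℂ) ^ 3 - m) / 12 * (3 / 2 - 3 * κ ^ 2) else 0) • 1 := by
  have e : ∀ k : ℤ, lOp κ m * gOp κ k =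
      gOp κ k * lOp κ m + ((m : ℂ) / 2 - (k + 1 / 2)) • gOp κ (m + k) := by
    intro k
    rw [add_comm]; exact sub_eq_iff_eq_add.mp (lOp_gOp κ m k)
  have e2 : ∀ i j : ℤ, lOp κ m * (gOp κ i * gOp κ j) = gOp κ i * gOp κ j * lOp κ m
      + ((m : ℂ) / 2 - (i + 1 / 2)) • (gOp κ (m + i) * gOp κ j)
      + ((m : ℂ) / 2 - (j + 1 / 2)) • (gOp κ i * gOp κ (m + j)) := by
    intro i j
    rw [← mul_assoc, e, add_mul, mul_assoc, e, mul_add, smul_mul_assoc, mul_smul_comm, mul_assoc]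
    abel
  have key : lOp κ m * gAnti κ (-1) n - gAnti κ (-1) n * lOp κ m =
      ((m : ℂ) / 2 + 1 / 2) • gAnti κ (m + -1) n +
        ((m : ℂ) / 2 - (n + 1 / 2)) • gAnti κ (-1) (m + n) := by
    rw [gAnti, mul_add, add_mul, e2, e2, gAnti, gAnti]
    push_cast
    module
  rw [show lOp κ n = (1 / 2 : ℂ) • gAnti κ (-1) n from rfl, mul_smul_comm, smul_mul_assoc,
    ← smul_sub, key, gAnti_eq, gAnti_eq, show m + -1 + n + 1 = m + n by ring,
    show -1 + (m + n) + 1 = m + n by ring]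
  by_cases h : m + n = 0
  · obtain rfl : n = -m := by omega
    simp only [h, if_true]
    push_cast
    module
  · simp only [if_neg h]
    module

/-! ### The homomorphism to the Fock space -/

/-- The operators on the Fock space assigned to the generators. -/
noncomputable def genOp (κ : ℂ) : Gen → Module.End ℂ Fock
  | Gen.L n => lOp κ n
  | Gen.G k => gOp κ k
  | Gen.C => (3 / 2 - 3 * κ ^ 2 : ℂ) • 1

theorem lift_rel (κ : ℂ) ⦃x y : FreeAlgebra ℂ Gen⦄ (h : Rel x y) :
    FreeAlgebra.lift ℂ (genOp κ) x = FreeAlgebra.lift ℂ (genOp κ) y := by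
  cases h with
  | LL m n =>
    simp only [fL, fC, map_sub, map_mul, map_add, map_smul, FreeAlgebra.lift_ι_apply, genOp,
      lOp_lOp]
    congr 1
    split_ifs
    · rw [smul_smul]
    · simp
  | LG m k =>
    simp only [fL, fG, map_sub, map_mul, map_smul, FreeAlgebra.lift_ι_apply, genOp, lOp_gOp]
  | GG j k =>
    simp only [fL, fG, fC, map_mul, map_add, map_smul, FreeAlgebra.lift_ι_apply, genOp]
    refine (gAnti_eq κ j k).trans ?_
    congr 1
    split_ifs
    · rw [smul_smul]; congr 1; ring
    · simp
  | CL n => simp [fL, fC, genOp]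
  | CG k => simp [fG, fC, genOp]

/-- The free-field representation of the Neveu-Schwarz algebra, of central charge `3/2 - 3 κ²`. -/
noncomputable def fockRep (κ : ℂ) : U →ₐ[ℂ] Module.End ℂ Fock :=
  RingQuot.liftAlgHom ℂ ⟨FreeAlgebra.lift ℂ (genOp κ), lift_rel κ⟩

theorem fockRep_L (κ : ℂ) (n : ℤ) : fockRep κ (L n) = lOp κ n := by
  simp [fockRep, L, fL, genOp]

theorem fockRep_G (κ : ℂ) (k : ℤ) : fockRep κ (G k) = gOp κ k := by
  simp [fockRep, G, fG, genOp]

theorem fockRep_C (κ : ℂ) : fockRep κ C = (3 / 2 - 3 * κ ^ 2 : ℂ) • 1 := by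
  simp [fockRep, C, fC, genOp]

/-- The free-field realisation of `V'_{p,q}`. The target carries the action through `fockRep κ`,
stated explicitly so that the Fock space gets no global module structure depending on `κ`. -/
theorem exists_fockMap {p q : ℤ} {κ : ℂ} (hκ : 3 / 2 - 3 * κ ^ 2 = cMin p q) :
    ∃ φ : VPrime p q →ₗ[ℂ] Fock, (∀ (u : U) (v : VPrime p q), φ (u • v) = fockRep κ u (φ v)) ∧
      φ (vac' p q) = vacuum := by
  let _ : Module U Fock := Module.compHom Fock (fockRep κ).toRingHom
  have hsmul : ∀ (u : U) (v : Fock), u • v = fockRep κ u v := fun _ _ => rfl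
  have : IsScalarTower ℂ U Fock := ⟨fun a u v => by
    rw [hsmul, hsmul, map_smul, LinearMap.smul_apply]⟩
  let f : U →ₗ[U] Fock := LinearMap.toSpanSingleton U Fock vacuum
  have hf : vermaIdeal (cMin p q) 0 ≤ LinearMap.ker f := by
    refine Submodule.span_le.mpr ?_
    rintro x ((⟨n, hn, rfl⟩ | ⟨k, hk, rfl⟩) | rfl | rfl) <;>
      rw [SetLike.mem_coe, LinearMap.mem_ker, LinearMap.toSpanSingleton_apply, hsmul]
    · rw [fockRep_L, lOp_vacuum κ (by omega)]
    · rw [fockRep_G, gOp_vacuum κ (by omega)]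
    · rw [map_zero, sub_zero, fockRep_L, lOp_vacuum κ (by omega)]
    · rw [map_sub, AlgHom.commutes, fockRep_C, hκ, Algebra.algebraMap_eq_smul_one, sub_self,
        LinearMap.zero_apply]
  let g : Verma (cMin p q) 0 →ₗ[U] Fock := (vermaIdeal (cMin p q) 0).liftQ f hf
  have hgvac : g (vac (cMin p q) 0) = vacuum := by
    change g ((vermaIdeal (cMin p q) 0).mkQ 1) = vacuum
    rw [Submodule.mkQ_apply, Submodule.liftQ_apply, LinearMap.toSpanSingleton_apply, one_smul]
  have hg : firstSub p q ≤ LinearMap.ker g := by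
    refine Submodule.span_le.mpr ?_
    rintro x rfl
    rw [SetLike.mem_coe, LinearMap.mem_ker, map_smul, hgvac, hsmul, fockRep_G,
      gOp_vacuum κ le_rfl]
  let φ : VPrime p q →ₗ[U] Fock := (firstSub p q).liftQ g hg
  refine ⟨φ.restrictScalars ℂ, fun u v => ?_, ?_⟩
  · rw [LinearMap.restrictScalars_apply, map_smul, hsmul, LinearMap.restrictScalars_apply]
  · rw [LinearMap.restrictScalars_apply, vac', proj, Submodule.mkQ_apply, Submodule.liftQ_apply,
      hgvac]

theorem exists_backgroundCharge (p q : ℤ) :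
    ∃ κ : ℂ, 3 / 2 - 3 * κ ^ 2 = cMin p q := by
  obtain ⟨κ, hκ⟩ := IsAlgClosed.exists_pow_nat_eq (((p : ℂ) - q) ^ 2 / (p * q)) (n := 2) (by simp)
  refine ⟨κ, ?_⟩
  rw [hκ, cMin]
  ring

/-! ### The weight filtration of the Fock space -/

/-- The weight of a basis vector: the number of its creation operators, with `a_{-1}` counted
twice. -/
noncomputable def Occ.wt (b : Occ) : ℤ := (b.1.degree : ℤ) + b.1 0 + b.2.card

/-- The weight of the bosonic creation operator `a_{-i-1}`. -/
def upWt (i : ℕ) : ℤ := if i = 0 then 2 else 1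

theorem one_le_upWt (i : ℕ) : 1 ≤ upWt i := by unfold upWt; split_ifs <;> norm_num

theorem wt_add_single (μ : ℕ →₀ ℕ) (S : Finset ℕ) (i : ℕ) :
    Occ.wt (μ + Finsupp.single i 1, S) = Occ.wt (μ, S) + upWt i := by
  unfold Occ.wt upWt
  by_cases h : i = 0
  · subst h
    simp only [map_add, Finsupp.degree_single, Finsupp.add_apply, Finsupp.single_eq_same, if_true]
    push_cast; ring
  · simp only [map_add, Finsupp.degree_single, Finsupp.add_apply,
      Finsupp.single_eq_of_ne (Ne.symm h), if_neg h]
    push_cast; ring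

theorem wt_insert (μ : ℕ →₀ ℕ) {S : Finset ℕ} {k : ℕ} (hk : k ∉ S) :
    Occ.wt (μ, insert k S) = Occ.wt (μ, S) + 1 := by
  unfold Occ.wt
  simp only [Finset.card_insert_of_notMem hk]
  push_cast; ring

theorem wt_sub_single {μ : ℕ →₀ ℕ} {i : ℕ} (h : μ i ≠ 0) (S : Finset ℕ) :
    Occ.wt (μ - Finsupp.single i 1, S) = Occ.wt (μ, S) - upWt i := by
  have h1 := wt_add_single (μ - Finsupp.single i 1) S i
  rw [tsub_add_cancel_of_le] at h1
  · omega
  · rw [Finsupp.single_le_iff]; omega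

theorem wt_erase (μ : ℕ →₀ ℕ) {S : Finset ℕ} {k : ℕ} (hk : k ∈ S) :
    Occ.wt (μ, S.erase k) = Occ.wt (μ, S) - 1 := by
  have h1 := wt_insert μ (Finset.notMem_erase k S)
  rw [Finset.insert_erase hk] at h1
  omega

/-- The span of the basis vectors of weight at most `w`. -/
noncomputable def fockLE (w : ℤ) : Submodule ℂ Fock := Submodule.span ℂ (ket '' {b | b.wt ≤ w})

theorem ket_mem_fockLE {b : Occ} {w : ℤ} (h : b.wt ≤ w) : ket b ∈ fockLE w :=
  Submodule.subset_span ⟨b, h, rfl⟩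

theorem fockLE_mono {w w' : ℤ} (h : w ≤ w') : fockLE w ≤ fockLE w' :=
  Submodule.span_mono (Set.image_mono fun _ hb => le_trans hb h)

theorem mem_fockLE_iff {v : Fock} {w : ℤ} :
    v ∈ fockLE w ↔ ∀ b : Occ, w < b.wt → ket.repr v b = 0 := by
  rw [fockLE, ket.mem_span_image]
  constructor
  · intro h b hb
    by_contra hne
    have : b.wt ≤ w := h (Finsupp.mem_support_iff.mpr hne)
    omega
  · intro h b hb
    by_contra hne
    exact Finsupp.mem_support_iff.mp hb (h b (not_le.mp hne))

/-- The operator `X` raises the weight filtration by at most `d`, which may be negative. -/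
def Raises (X : Module.End ℂ Fock) (d : ℤ) : Prop := ∀ w, ∀ v ∈ fockLE w, X v ∈ fockLE (w + d)

theorem raises_of_ket {X : Module.End ℂ Fock} {d : ℤ}
    (h : ∀ μ S, X (ket (μ, S)) ∈ fockLE (Occ.wt (μ, S) + d)) : Raises X d := by
  intro w v hv
  induction hv using Submodule.span_induction with
  | mem x hx =>
    obtain ⟨b, hb, rfl⟩ := hx
    exact fockLE_mono (add_le_add_left hb d) (h b.1 b.2)
  | zero => rw [map_zero]; exact zero_mem _
  | add x y _ _ hx hy => rw [map_add]; exact add_mem hx hy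
  | smul c x _ hx => rw [map_smul]; exact Submodule.smul_mem _ c hx

theorem Raises.mono {X : Module.End ℂ Fock} {d d' : ℤ} (h : Raises X d) (hd : d ≤ d') :
    Raises X d' := fun w v hv => fockLE_mono (by omega) (h w v hv)

theorem Raises.mem {X : Module.End ℂ Fock} {d w w' : ℤ} (h : Raises X d) {v : Fock}
    (hv : v ∈ fockLE w) (hw : w + d ≤ w') : X v ∈ fockLE w' := fockLE_mono hw (h w v hv)

theorem raises_bosonUp (i : ℕ) : Raises (bosonUp i) (upWt i) :=
  raises_of_ket fun μ S => by
    rw [bosonUp_ket]; exact ket_mem_fockLE (wt_add_single μ S i).le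

theorem raises_bosonDown (i : ℕ) : Raises (bosonDown i) (-upWt i) :=
  raises_of_ket fun μ S => by
    rw [bosonDown_ket]
    by_cases h : μ i = 0
    · rw [h, Nat.cast_zero, zero_smul]; exact zero_mem _
    · exact Submodule.smul_mem _ _ (ket_mem_fockLE (wt_sub_single h S).le)

theorem raises_fermionUp (k : ℕ) : Raises (fermionUp k) 1 :=
  raises_of_ket fun μ S => by
    rw [fermionUp_ket]
    split_ifs with h
    · exact zero_mem _
    · exact Submodule.smul_mem _ _ (ket_mem_fockLE (wt_insert μ h).le)

theorem raises_fermionDown (k : ℕ) : Raises (fermionDown k) (-1) :=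
  raises_of_ket fun μ S => by
    rw [fermionDown_ket]
    split_ifs with h
    · exact Submodule.smul_mem _ _ (ket_mem_fockLE (wt_erase μ h).le)
    · exact zero_mem _

theorem raises_aMode_neg_one : Raises (aMode (-1)) 2 := raises_bosonUp 0

theorem raises_aMode_of_lt {n : ℤ} (hn : n ≤ -2) : Raises (aMode n) 1 := by
  obtain ⟨i, rfl⟩ := Int.eq_negSucc_of_lt_zero (show n < 0 by omega)
  have := raises_bosonUp i
  rwa [upWt, if_neg (by rintro rfl; revert hn; decide)] at this

theorem raises_aMode_of_nonneg {n : ℤ} (hn : 0 ≤ n) : Raises (aMode n) (-1) := by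
  rcases n with (_ | i) | i
  · intro w v _; exact zero_mem _
  · intro w v hv
    refine Submodule.smul_mem _ _ ((raises_bosonDown i).mem hv ?_)
    have := one_le_upWt i
    omega
  · simp at hn

theorem raises_aMode_of_ne {n : ℤ} (hn : n ≠ -1) : Raises (aMode n) 1 := by
  rcases le_or_gt 0 n with h | h
  · exact (raises_aMode_of_nonneg h).mono (by norm_num)
  · exact raises_aMode_of_lt (by omega)

theorem raises_aMode (n : ℤ) : Raises (aMode n) 2 := by
  by_cases h : n = -1
  · rw [h]; exact raises_aMode_neg_one
  · exact (raises_aMode_of_ne h).mono (by norm_num)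

theorem raises_psiMode_of_nonneg {k : ℤ} (hk : 0 ≤ k) : Raises (psiMode k) (-1) := by
  rcases k with k | k
  · exact raises_fermionDown k
  · simp at hk

theorem raises_psiMode (k : ℤ) : Raises (psiMode k) 1 := by
  rcases k with k | k
  · exact (raises_fermionDown k).mono (by norm_num)
  · exact raises_fermionUp k

theorem finsum_sub_sum_mem {f : ℤ → Fock} (hf : (Function.support f).Finite) (s : Finset ℤ)
    {W : Submodule ℂ Fock} (h : ∀ n, n ∉ s → f n ∈ W) : ∑ᶠ n, f n - ∑ n ∈ s, f n ∈ W := by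
  rw [finsum_eq_sum_of_support_subset (s := s ∪ hf.toFinset) f (by
    intro n hn; simp only [Finset.coe_union, Set.Finite.coe_toFinset]; exact Or.inr hn),
    ← Finset.sum_sdiff (Finset.subset_union_left (s₁ := s) (s₂ := hf.toFinset)),
    add_sub_cancel_right]
  exact sum_mem fun n hn => h n (Finset.mem_sdiff.mp hn).2

/-- Up to lower weight, `G_{k+1/2}` acts as `a_{-1} ψ_{k+3/2}`, both for negative and for positive
modes. -/
theorem gOp_lead (κ : ℂ) (k : ℤ) {w d : ℤ} {v : Fock} (hv : v ∈ fockLE w)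
    (hd : (k ≤ -2 ∧ d = 2) ∨ (0 ≤ k ∧ d = 0)) :
    gOp κ k v - aMode (-1) (psiMode (k + 1) v) ∈ fockLE (w + d) := by
  have h1 : (∑ᶠ n : ℤ, aMode n (psiMode (k - n) v)) - aMode (-1) (psiMode (k + 1) v)
      ∈ fockLE (w + d) := by
    have := finsum_sub_sum_mem (finite_support_gOp k v) {-1} (W := fockLE (w + d)) ?_
    · rwa [Finset.sum_singleton, sub_neg_eq_add] at this
    · intro n hn
      rw [Finset.mem_singleton] at hn
      rcases le_or_gt 0 n with h | h
      · exact (raises_aMode_of_nonneg h).mem (raises_psiMode _ _ _ hv) (by omega)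
      · rcases hd with hd | hd
        · exact (raises_aMode_of_lt (by omega)).mem (raises_psiMode _ _ _ hv) (by omega)
        · exact (raises_aMode_of_lt (by omega)).mem
            (raises_psiMode_of_nonneg (by omega) _ _ hv) (by omega)
  have h2 : (κ * (k + 1)) • psiMode k v ∈ fockLE (w + d) := by
    apply Submodule.smul_mem
    rcases hd with hd | hd
    · exact (raises_psiMode k).mem hv (by omega)
    · exact (raises_psiMode_of_nonneg hd.1).mem hv (by omega)
  rw [gOp_apply, add_sub_right_comm]
  exact add_mem h1 h2

/-- To bound how far an operator raises the filtration it suffices to know its value on the vacuum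
and its commutators with the creation operators. -/
theorem raises_of_comm {X : Module.End ℂ Fock} {d : ℤ} (vac : X vacuum ∈ fockLE d)
    (boson : ∀ i w, ∀ v ∈ fockLE w,
      X (bosonUp i v) - bosonUp i (X v) ∈ fockLE (w + upWt i + d))
    (fermion : ∀ k w, ∀ v ∈ fockLE w,
      X (fermionUp k v) - fermionUp k (X v) ∈ fockLE (w + 1 + d)) : Raises X d := by
  suffices h : ∀ b : Occ, X (ket b) ∈ fockLE (b.wt + d) from raises_of_ket fun μ S => h (μ, S)
  intro b
  induction b using Occ.induction with
  | vac => exact fockLE_mono (by simp [Occ.wt]) vac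
  | boson i μ S ih =>
    have h1 := boson i _ _ (ket_mem_fockLE (le_refl (Occ.wt (μ, S))))
    have h2 : bosonUp i (X (ket (μ, S))) ∈ fockLE (Occ.wt (μ, S) + upWt i + d) :=
      (raises_bosonUp i).mem ih (by omega)
    have h3 := add_mem h1 h2
    rwa [sub_add_cancel, bosonUp_ket, ← wt_add_single] at h3
  | fermion k μ S hk ih =>
    have h1 := fermion k _ _ (ket_mem_fockLE (le_refl (Occ.wt (μ, S))))
    have h2 : fermionUp k (X (ket (μ, S))) ∈ fockLE (Occ.wt (μ, S) + 1 + d) :=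
      (raises_fermionUp k).mem ih (by omega)
    have h3 := add_mem h1 h2
    rw [sub_add_cancel, fermionUp_ket, if_neg hk, map_smul] at h3
    rw [wt_insert _ hk]
    exact (Submodule.smul_mem_iff _ (jwSign_ne_zero k S)).mp h3

/-- The coefficient of `a_{-1} a_{n+1}` in `L_n` for `n ≤ -2`. For `n ≠ -2` the two orderings of the
product in `(1/2) ∑ a_i a_{n-i}` contribute equally; for `n = -2` there is only `a_{-1}²`. -/
noncomputable def leadCoeff (n : ℤ) : ℂ := if n = -2 then 1 / 2 else 1

theorem leadCoeff_ne_zero (n : ℤ) : leadCoeff n ≠ 0 := by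
  unfold leadCoeff; split_ifs <;> norm_num

/-- The leading term of `L_n` on the vacuum, where `2 L_n` acts as `G_{-1/2} G_{n+1/2}`. -/
theorem gOp_neg_one_gOp_vacuum (κ : ℂ) {n : ℤ} (hn : n ≤ -2) :
    gOp κ (-1) (gOp κ n vacuum) - (2 * leadCoeff n) • aMode (-1) (aMode (n + 1) vacuum)
      ∈ fockLE 2 := by
  have hvac : vacuum ∈ fockLE 0 := ket_mem_fockLE (by simp [Occ.wt])
  have hψ : ∀ k : ℤ, gOp κ (-1) (psiMode k vacuum) = aMode k vacuum := by
    intro k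
    have e := LinearMap.congr_fun (gOp_psiMode κ (-1) k) vacuum
    simp only [Module.End.mul_apply, LinearMap.add_apply, LinearMap.neg_apply,
      LinearMap.smul_apply, Module.End.one_apply] at e
    rw [e, gOp_vacuum κ le_rfl, map_zero, neg_zero, zero_add, show -1 + k + 1 = k by ring]
    simp
  have hterm : ∀ l : ℤ, gOp κ (-1) (aMode l (psiMode (n - l) vacuum)) =
      aMode l (aMode (n - l) vacuum) - (l : ℂ) • psiMode (-1 + l) (psiMode (n - l) vacuum) := by
    intro l
    have e := LinearMap.congr_fun (gOp_aMode κ (-1) l) (psiMode (n - l) vacuum)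
    simp only [Module.End.mul_apply, LinearMap.sub_apply, LinearMap.smul_apply] at e
    rw [e, hψ]
  have hψψ : ∀ l : ℤ, (l : ℂ) • psiMode (-1 + l) (psiMode (n - l) vacuum) ∈ fockLE 2 := fun l =>
    Submodule.smul_mem _ _ ((raises_psiMode _).mem (raises_psiMode _ _ _ hvac) (by norm_num))
  have hfin : (Function.support fun l : ℤ =>
      gOp κ (-1) (aMode l (psiMode (n - l) vacuum))).Finite :=
    (finite_support_gOp n vacuum).subset fun l hl hl' => hl (by
      have : aMode l (psiMode (n - l) vacuum) = 0 := hl'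
      simp only [this, map_zero])
  have h1 := finsum_sub_sum_mem hfin {-1, n + 1} (W := fockLE 2) (by
    intro l hl
    simp only [Finset.mem_insert, Finset.mem_singleton, not_or] at hl
    rw [hterm]
    refine sub_mem ?_ (hψψ l)
    rcases le_or_gt 0 l with h | h
    · have e := LinearMap.congr_fun (aMode_comm l (n - l)) vacuum
      rw [if_neg (by omega)] at e
      simp only [Module.End.mul_apply, aMode_vacuum h, map_zero, zero_smul,
        add_zero] at e
      rw [e]; exact zero_mem _
    · exact (raises_aMode_of_ne hl.1).mem
        (raises_aMode_of_ne (n := n - l) (by omega) _ _ hvac) (by norm_num))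
  have h2 : ∑ l ∈ ({-1, n + 1} : Finset ℤ), gOp κ (-1) (aMode l (psiMode (n - l) vacuum)) -
      (2 * leadCoeff n) • aMode (-1) (aMode (n + 1) vacuum) ∈ fockLE 2 := by
    unfold leadCoeff
    by_cases h : n = -2
    · subst h
      norm_num only [Finset.insert_eq_of_mem, Finset.mem_singleton, Finset.sum_singleton, if_true]
      have e := hterm (-1)
      have h3 := neg_mem (hψψ (-1))
      norm_num at e h3 ⊢
      rw [e]
      simpa using h3
    · rw [Finset.sum_pair (by omega), hterm, hterm, if_neg h]
      have e := LinearMap.congr_fun (aMode_comm (n + 1) (-1)) vacuum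
      rw [if_neg (by omega)] at e
      simp only [Module.End.mul_apply, zero_smul,
        add_zero] at e
      rw [show n - (n + 1) = -1 by ring, e, show n - -1 = n + 1 by ring]
      have h3 := hψψ (-1)
      have h4 := hψψ (n + 1)
      rw [show n - (n + 1) = -1 by ring] at h4
      rw [show n - -1 = n + 1 by ring] at h3
      have := neg_mem (add_mem h3 h4)
      convert this using 1
      module
  have h3 : (κ * (n + 1)) • aMode n vacuum ∈ fockLE 2 :=
    Submodule.smul_mem _ _ ((raises_aMode n).mem hvac (by norm_num))
  rw [gOp_apply κ n, map_add, map_finsum (gOp κ (-1)) (finite_support_gOp n vacuum), map_smul,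
    hψ]
  have := add_mem (add_mem h1 h2) h3
  convert this using 1
  abel

/-- Up to lower weight, `L_n` with `n ≤ -2` acts as a multiple of `a_{-1} a_{n+1}`. -/
theorem lOp_lead (κ : ℂ) {n : ℤ} (hn : n ≤ -2) :
    Raises (lOp κ n - leadCoeff n • (aMode (-1) * aMode (n + 1))) 2 := by
  apply raises_of_comm
  · have h := Submodule.smul_mem _ (1 / 2 : ℂ) (gOp_neg_one_gOp_vacuum κ hn)
    convert h using 1
    simp only [lOp, gAnti, LinearMap.sub_apply, LinearMap.smul_apply, LinearMap.add_apply,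
      Module.End.mul_apply, gOp_vacuum κ le_rfl, map_zero]
    module
  · intro i w v hv
    have e1 := LinearMap.congr_fun (lOp_aMode κ n (Int.negSucc i)) v
    have e2 := LinearMap.congr_fun (aMode_comm (n + 1) (Int.negSucc i)) v
    have e3 := LinearMap.congr_fun (aMode_comm (-1) (Int.negSucc i)) (aMode (n + 1) v)
    rw [if_neg (by rw [Int.negSucc_eq]; omega)] at e1 e2 e3
    simp only [Module.End.mul_apply, LinearMap.sub_apply, zero_smul,
      add_zero, sub_zero, LinearMap.smul_apply] at e1 e2 e3
    have e : (lOp κ n - leadCoeff n • (aMode (-1) * aMode (n + 1))) (bosonUp i v) -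
        bosonUp i ((lOp κ n - leadCoeff n • (aMode (-1) * aMode (n + 1))) v) =
        -((Int.negSucc i : ℤ) : ℂ) • aMode (n + Int.negSucc i) v := by
      change (lOp κ n - leadCoeff n • (aMode (-1) * aMode (n + 1))) (aMode (Int.negSucc i) v) -
        aMode (Int.negSucc i) ((lOp κ n - leadCoeff n • (aMode (-1) * aMode (n + 1))) v) = _
      simp only [LinearMap.sub_apply, LinearMap.smul_apply, Module.End.mul_apply, map_sub,
        map_smul, e1, e2, e3]
      module
    rw [e]
    refine Submodule.smul_mem _ _ ((raises_aMode_of_lt (by rw [Int.negSucc_eq]; omega)).mem hv ?_)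
    have := one_le_upWt i
    omega
  · intro k w v hv
    have e1 := LinearMap.congr_fun (lOp_psiMode κ n (Int.negSucc k)) v
    have e2 := LinearMap.congr_fun (aMode_psiMode (n + 1) (Int.negSucc k)) v
    have e3 := LinearMap.congr_fun (aMode_psiMode (-1) (Int.negSucc k)) (aMode (n + 1) v)
    simp only [Module.End.mul_apply, LinearMap.sub_apply, LinearMap.smul_apply] at e1 e2 e3
    have e : (lOp κ n - leadCoeff n • (aMode (-1) * aMode (n + 1))) (fermionUp k v) -
        fermionUp k ((lOp κ n - leadCoeff n • (aMode (-1) * aMode (n + 1))) v) =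
        -(((n : ℂ) + 2 * (Int.negSucc k : ℤ) + 1) / 2) • psiMode (n + Int.negSucc k) v := by
      change (lOp κ n - leadCoeff n • (aMode (-1) * aMode (n + 1))) (psiMode (Int.negSucc k) v) -
        psiMode (Int.negSucc k) ((lOp κ n - leadCoeff n • (aMode (-1) * aMode (n + 1))) v) = _
      simp only [LinearMap.sub_apply, LinearMap.smul_apply, Module.End.mul_apply, map_sub,
        map_smul, e1, e2, e3]
      module
    rw [e]
    exact Submodule.smul_mem _ _ ((raises_psiMode _).mem hv (by omega))

/-- Up to lower weight, `L_n` with `n ≥ 1` acts as `a_{-1} a_{n+1}`. -/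
theorem lOp_pos_lead (κ : ℂ) {n : ℤ} (hn : 1 ≤ n) :
    Raises (lOp κ n - aMode (-1) * aMode (n + 1)) 0 := by
  apply raises_of_comm
  · rw [LinearMap.sub_apply, Module.End.mul_apply, lOp_vacuum κ (by omega),
      aMode_vacuum (by omega), map_zero, sub_zero]
    exact zero_mem _
  · intro i w v hv
    have e1 := LinearMap.congr_fun (lOp_aMode κ n (Int.negSucc i)) v
    have e2 := LinearMap.congr_fun (aMode_comm (n + 1) (Int.negSucc i)) v
    have e3 := LinearMap.congr_fun (aMode_comm (-1) (Int.negSucc i)) (aMode (n + 1) v)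
    rw [if_neg (by rw [Int.negSucc_eq]; omega)] at e3
    simp only [Module.End.mul_apply, LinearMap.add_apply, LinearMap.sub_apply, zero_smul,
      add_zero, LinearMap.smul_apply, Module.End.one_apply] at e1 e2 e3
    have e : (lOp κ n - aMode (-1) * aMode (n + 1)) (bosonUp i v) -
        bosonUp i ((lOp κ n - aMode (-1) * aMode (n + 1)) v) =
        (-((Int.negSucc i : ℤ) : ℂ) • aMode (n + Int.negSucc i) v -
          (if n + 1 + Int.negSucc i = 0 then ((n + 1 : ℤ) : ℂ) else 0) • aMode (-1) v) -
        (if n + Int.negSucc i = 0 then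
          ((Int.negSucc i : ℤ) : ℂ) * κ * (n + 1) / 2 else 0) • v := by
      change (lOp κ n - aMode (-1) * aMode (n + 1)) (aMode (Int.negSucc i) v) -
        aMode (Int.negSucc i) ((lOp κ n - aMode (-1) * aMode (n + 1)) v) = _
      simp only [LinearMap.sub_apply, Module.End.mul_apply, map_sub, map_add,
        map_smul, e1, e2, e3]
      module
    have hi := one_le_upWt i
    rw [e]
    refine sub_mem ?_ (Submodule.smul_mem _ _ (fockLE_mono (by omega) hv))
    by_cases h : n + 1 + Int.negSucc i = 0
    · rw [if_pos h, show n + Int.negSucc i = -1 by omega, ← sub_smul,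
        show Int.negSucc i = -(n + 1) by omega]
      push_cast
      simp
    · rw [if_neg h, zero_smul, sub_zero]
      exact Submodule.smul_mem _ _ ((raises_aMode_of_ne (by omega)).mem hv (by omega))
  · intro k w v hv
    have e1 := LinearMap.congr_fun (lOp_psiMode κ n (Int.negSucc k)) v
    have e2 := LinearMap.congr_fun (aMode_psiMode (n + 1) (Int.negSucc k)) v
    have e3 := LinearMap.congr_fun (aMode_psiMode (-1) (Int.negSucc k)) (aMode (n + 1) v)
    simp only [Module.End.mul_apply, LinearMap.sub_apply, LinearMap.smul_apply] at e1 e2 e3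
    have e : (lOp κ n - aMode (-1) * aMode (n + 1)) (fermionUp k v) -
        fermionUp k ((lOp κ n - aMode (-1) * aMode (n + 1)) v) =
        -(((n : ℂ) + 2 * (Int.negSucc k : ℤ) + 1) / 2) • psiMode (n + Int.negSucc k) v := by
      change (lOp κ n - aMode (-1) * aMode (n + 1)) (psiMode (Int.negSucc k) v) -
        psiMode (Int.negSucc k) ((lOp κ n - aMode (-1) * aMode (n + 1)) v) = _
      simp only [LinearMap.sub_apply, Module.End.mul_apply, map_sub, e1, e2, e3]
      module
    rw [e]
    exact Submodule.smul_mem _ _ ((raises_psiMode _).mem hv (by omega))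

/-! ### The top weight part of a singular vector -/

theorem repr_bosonUp (i : ℕ) (v : Fock) (μ : ℕ →₀ ℕ) (S : Finset ℕ) :
    ket.repr (bosonUp i v) (μ + Finsupp.single i 1, S) = ket.repr v (μ, S) := by
  have h : ket.coord (μ + Finsupp.single i 1, S) ∘ₗ bosonUp i = ket.coord (μ, S) := by
    refine ket.ext fun b => ?_
    rw [LinearMap.comp_apply, bosonUp_ket, ket.coord_apply, ket.coord_apply, ket.repr_self,
      ket.repr_self, Finsupp.single_apply, Finsupp.single_apply]
    simp [Prod.ext_iff]
  exact LinearMap.congr_fun h v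

theorem repr_bosonDown (i : ℕ) (v : Fock) (μ : ℕ →₀ ℕ) (S : Finset ℕ) :
    ket.repr (bosonDown i v) (μ, S) =
      ((μ i : ℂ) + 1) * ket.repr v (μ + Finsupp.single i 1, S) := by
  have h : ket.coord (μ, S) ∘ₗ bosonDown i =
      ((μ i : ℂ) + 1) • ket.coord (μ + Finsupp.single i 1, S) := by
    refine ket.ext fun ⟨ν, T⟩ => ?_
    rw [LinearMap.comp_apply, bosonDown_ket, LinearMap.smul_apply, map_smul, ket.coord_apply,
      ket.coord_apply, ket.repr_self, ket.repr_self, Finsupp.single_apply, Finsupp.single_apply]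
    by_cases h0 : ν i = 0
    · have h1 : (ν, T) ≠ (μ + Finsupp.single i 1, S) := by
        intro h
        rw [(Prod.mk.inj h).1] at h0
        simp at h0
      rw [h0, if_neg h1, Nat.cast_zero, zero_smul, smul_zero]
    · have hle : Finsupp.single i 1 ≤ ν := by rw [Finsupp.single_le_iff]; omega
      by_cases h1 : ν = μ + Finsupp.single i 1
      · subst h1; simp
      · rw [if_neg, if_neg]
        · simp
        · simp [h1]
        · intro h
          rw [Prod.mk.injEq] at h
          exact h1 (by rw [← h.1, tsub_add_cancel_of_le hle])
  exact LinearMap.congr_fun h v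

theorem repr_fermionDown (k : ℕ) (v : Fock) (μ : ℕ →₀ ℕ) {S : Finset ℕ} (hk : k ∉ S) :
    ket.repr (fermionDown k v) (μ, S) = jwSign k S * ket.repr v (μ, insert k S) := by
  have h : ket.coord (μ, S) ∘ₗ fermionDown k = jwSign k S • ket.coord (μ, insert k S) := by
    refine ket.ext fun ⟨ν, T⟩ => ?_
    rw [LinearMap.comp_apply, fermionDown_ket, LinearMap.smul_apply, ket.coord_apply,
      ket.coord_apply, ket.repr_self, Finsupp.single_apply]
    by_cases h0 : (ν, T) = (μ, insert k S)
    · obtain ⟨rfl, rfl⟩ := Prod.mk.inj h0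
      rw [if_pos (Finset.mem_insert_self k S), if_pos rfl, Finset.erase_insert hk,
        jwSign_insert hk, if_neg (lt_irrefl k), map_smul, ket.repr_self]
      simp
    · rw [if_neg h0, smul_zero]
      split_ifs with h1
      · rw [map_smul, ket.repr_self, Finsupp.smul_apply, Finsupp.single_apply, if_neg, smul_zero]
        intro h
        obtain ⟨h2, h3⟩ := Prod.mk.inj h
        exact h0 (by rw [h2, ← h3, Finset.insert_erase h1])
      · simp
  exact LinearMap.congr_fun h v

theorem mem_fockLE_of_bosonUp {v : Fock} {w : ℤ} (h : aMode (-1) v ∈ fockLE w) :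
    v ∈ fockLE (w - 2) := by
  rw [mem_fockLE_iff] at h ⊢
  rintro ⟨μ, S⟩ hb
  have := h (μ + Finsupp.single 0 1, S) (by
    rw [wt_add_single, upWt, if_pos rfl]; omega)
  rw [← repr_bosonUp 0 v]; exact this

/-- In a vector killed by all positive modes, the basis vectors of top weight involve no creation
operators besides `a_{-1}` and `ψ_{-1/2}`: the leading part `a_{-1} a_{n+1}` of `L_n` must kill the
top weight part, and `a_{-1}` is injective on it; likewise for `a_{-1} ψ_{r+1}` and `G_r`. -/
theorem singular_top {κ : ℂ} {v : Fock} (hL : ∀ n : ℤ, 0 < n → lOp κ n v = 0)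
    (hG : ∀ k : ℤ, 0 ≤ k → gOp κ k v = 0) {w : ℤ} (hv : v ∈ fockLE w) {b : Occ} (hb : b.wt = w)
    (hne : ket.repr v b ≠ 0) : (∀ n, n ≠ 0 → b.1 n = 0) ∧ ∀ k, k ≠ 0 → k ∉ b.2 := by
  obtain ⟨μ, S⟩ := b
  constructor
  · intro n hn
    by_contra h0
    replace h0 : μ n ≠ 0 := h0
    have hb' : Occ.wt (μ, S) = w := hb
    have hle : Finsupp.single n 1 ≤ μ := by
      rw [Finsupp.single_le_iff]; exact Nat.one_le_iff_ne_zero.mpr h0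
    have h1 := lOp_pos_lead κ (n := n) (by omega) w v hv
    rw [LinearMap.sub_apply, hL n (by omega), zero_sub, add_zero, neg_mem_iff,
      Module.End.mul_apply] at h1
    have h2 := mem_fockLE_of_bosonUp h1
    have h3 : bosonDown n v ∈ fockLE (w - 2) := by
      have : (n : ℂ) + 1 ≠ 0 := by exact_mod_cast Nat.succ_ne_zero n
      exact (Submodule.smul_mem_iff _ this).mp h2
    have h4 := mem_fockLE_iff.mp h3 (μ - Finsupp.single n 1, S) (by
      rw [wt_sub_single h0, upWt, if_neg hn]; omega)
    rw [repr_bosonDown, tsub_add_cancel_of_le hle] at h4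
    rcases mul_eq_zero.mp h4 with h | h
    · exact Nat.cast_add_one_ne_zero (R := ℂ) _ h
    · exact hne h
  · intro k hk hkS
    obtain ⟨k, rfl⟩ := Nat.exists_eq_add_one_of_ne_zero hk
    have h1 := gOp_lead κ (k : ℤ) hv (Or.inr ⟨by omega, rfl⟩)
    rw [hG k (by omega), zero_sub, add_zero, neg_mem_iff] at h1
    have h3 : fermionDown (k + 1) v ∈ fockLE (w - 2) := mem_fockLE_of_bosonUp h1
    have h4 := mem_fockLE_iff.mp h3 (μ, S.erase (k + 1)) (by
      have hb' : Occ.wt (μ, S) = w := hb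
      have := wt_erase μ (S := S) hkS
      omega)
    rw [repr_fermionDown _ _ _ (Finset.notMem_erase _ _), Finset.insert_erase hkS] at h4
    rcases mul_eq_zero.mp h4 with h | h
    · exact jwSign_ne_zero _ _ h
    · exact hne h

/-- The `L_0`-eigenvalue of a basis vector of the Fock space. -/
noncomputable def Occ.level (b : Occ) : ℂ :=
  (b.1.sum fun i n => (n : ℂ) * (i + 1)) + ∑ k ∈ b.2, ((k : ℂ) + 1 / 2)

theorem lOp_zero_ket (κ : ℂ) (b : Occ) : lOp κ 0 (ket b) = b.level • ket b := by
  induction b using Occ.induction with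
  | vac => simp only [Occ.level, Finsupp.sum_zero_index, Finset.sum_empty, add_zero, zero_smul]
           exact lOp_vacuum κ (by norm_num)
  | boson i μ S ih =>
    have e := LinearMap.congr_fun (lOp_aMode κ 0 (Int.negSucc i)) (ket (μ, S))
    rw [if_neg (by rw [Int.negSucc_eq]; omega)] at e
    simp only [Module.End.mul_apply, LinearMap.sub_apply, zero_smul,
      sub_zero, LinearMap.smul_apply, ih, zero_add, aMode, bosonUp_ket,
      map_smul] at e
    rw [e, ← sub_smul]
    congr 1
    simp only [Occ.level]
    rw [Finsupp.sum_add_index' (by simp) (by intros; push_cast; ring), Finsupp.sum_single_index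
      (by simp), Int.negSucc_eq]
    push_cast
    ring
  | fermion k μ S hk ih =>
    have e := LinearMap.congr_fun (lOp_psiMode κ 0 (Int.negSucc k)) (ket (μ, S))
    simp only [Module.End.mul_apply, LinearMap.sub_apply, LinearMap.smul_apply, ih, zero_add,
      psiMode, fermionUp_ket, if_neg hk, map_smul, smul_smul, ← sub_smul] at e
    rw [← smul_right_injective Fock (jwSign_ne_zero k S) |>.eq_iff]
    simp only [e, smul_smul]
    congr 1
    simp only [Occ.level, Finset.sum_insert hk]
    rw [Int.negSucc_eq]
    push_cast
    ring

theorem level_eq_of_eigenvector {κ : ℂ} {v : Fock} {N : ℂ} (hv : lOp κ 0 v = N • v) {b : Occ}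
    (hb : ket.repr v b ≠ 0) : b.level = N := by
  have h : ket.coord b ∘ₗ lOp κ 0 = b.level • ket.coord b := by
    refine ket.ext fun b' => ?_
    rw [LinearMap.comp_apply, lOp_zero_ket, map_smul, LinearMap.smul_apply, ket.coord_apply,
      ket.repr_self, Finsupp.single_apply]
    split_ifs with h
    · rw [h]
    · simp
  have h1 := LinearMap.congr_fun h v
  rw [LinearMap.comp_apply, hv, map_smul, LinearMap.smul_apply, ket.coord_apply] at h1
  exact (mul_right_cancel₀ hb h1).symm

/-- A singular vector of degree `N` in the Fock space contains `a_{-1}^N` or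
`a_{-1}^{N-1/2} ψ_{-1/2}` with non-zero coefficient. -/
theorem exists_top {κ : ℂ} {v : Fock} (h0 : v ≠ 0) (hL : ∀ n : ℤ, 0 < n → lOp κ n v = 0)
    (hG : ∀ k : ℤ, 0 ≤ k → gOp κ k v = 0) {N : ℂ} (hN : lOp κ 0 v = N • v) :
    ∃ j : ℕ, (ket.repr v (Finsupp.single 0 j, ∅) ≠ 0 ∧ (j : ℂ) = N) ∨
      (ket.repr v (Finsupp.single 0 j, {0}) ≠ 0 ∧ (j : ℂ) + 1 / 2 = N) := by
  have hne : (ket.repr v).support.Nonempty := by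
    rw [Finsupp.support_nonempty_iff]; simpa using h0
  obtain ⟨⟨μ, S⟩, hb, hmax⟩ := Finset.exists_max_image _ Occ.wt hne
  have hv : v ∈ fockLE (Occ.wt (μ, S)) := by
    rw [mem_fockLE_iff]
    intro b' hb'
    by_contra h
    exact absurd (hmax b' (Finsupp.mem_support_iff.mpr h)) (not_le.mpr hb')
  rw [Finsupp.mem_support_iff] at hb
  obtain ⟨h1, h2⟩ := singular_top hL hG hv rfl hb
  have hμ : μ = Finsupp.single 0 (μ 0) := by
    ext n
    by_cases hn : n = 0
    · subst hn; simp
    · rw [Finsupp.single_eq_of_ne hn]; exact h1 n hn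
  have hlev := level_eq_of_eigenvector hN hb
  refine ⟨μ 0, ?_⟩
  by_cases h : 0 ∈ S
  · have hS : S = {0} := by
      ext k
      rw [Finset.mem_singleton]
      exact ⟨fun hk => by_contra fun hk' => h2 k hk' hk, fun hk => hk ▸ h⟩
    right
    rw [hS, hμ] at hb hlev
    simp only [Occ.level] at hlev
    rw [Finsupp.sum_single_index (by simp)] at hlev
    refine ⟨hb, ?_⟩
    simpa using hlev
  · have hS : S = ∅ := by
      ext k
      simp only [Finset.notMem_empty, iff_false]
      intro hk
      by_cases hk' : k = 0
      · exact h (hk' ▸ hk)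
      · exact h2 k hk' hk
    left
    rw [hS, hμ] at hb hlev
    simp only [Occ.level] at hlev
    rw [Finsupp.sum_single_index (by simp)] at hlev
    refine ⟨hb, ?_⟩
    simpa using hlev

/-! ### Leading terms of monomials -/

/-- The vector `v` is a non-zero multiple of the basis vector `ket b` up to lower weight. -/
def HasLead (v : Fock) (b : Occ) : Prop := ∃ c : ℂ, c ≠ 0 ∧ v - c • ket b ∈ fockLE (b.wt - 1)

theorem HasLead.mem {v : Fock} {b : Occ} (h : HasLead v b) : v ∈ fockLE b.wt := by
  obtain ⟨c, -, h⟩ := h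
  have := add_mem (fockLE_mono (by omega) h)
    (Submodule.smul_mem _ c (ket_mem_fockLE (le_refl b.wt)))
  rwa [sub_add_cancel] at this

theorem hasLead_vacuum : HasLead vacuum (0, ∅) :=
  ⟨1, one_ne_zero, by rw [one_smul, vacuum, sub_self]; exact zero_mem _⟩

theorem HasLead.lOp {κ : ℂ} {n : ℤ} (hn : n ≤ -2) {v : Fock} {μ : ℕ →₀ ℕ} {S : Finset ℕ}
    (h : HasLead v (μ, S)) : HasLead (lOp κ n v)
      (μ + Finsupp.single (-n - 2).toNat 1 + Finsupp.single 0 1, S) := by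
  obtain ⟨c, hc, hr⟩ := id h
  obtain ⟨i, rfl⟩ : ∃ i : ℕ, n = Int.negSucc i - 1 := ⟨(-n - 2).toNat, by
    rw [Int.negSucc_eq]; omega⟩
  have hi : (-(Int.negSucc i - 1) - 2).toNat = i := by rw [Int.negSucc_eq]; omega
  rw [hi]
  set ξ := leadCoeff (Int.negSucc i - 1) with hξ
  refine ⟨ξ * c, mul_ne_zero (leadCoeff_ne_zero _) hc, ?_⟩
  have hwt : Occ.wt (μ + Finsupp.single i 1 + Finsupp.single 0 1, S) =
      Occ.wt (μ, S) + upWt i + 2 := by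
    rw [wt_add_single, wt_add_single, upWt, upWt, if_pos rfl]
  have hup := one_le_upWt i
  have h1 := lOp_lead κ hn _ _ h.mem
  have h2 : bosonUp 0 (bosonUp i (v - c • ket (μ, S))) ∈
      fockLE (Occ.wt (μ, S) - 1 + upWt i + 2) := raises_bosonUp 0 _ _ (raises_bosonUp i _ _ hr)
  rw [map_sub, map_sub, map_smul, map_smul, bosonUp_ket, bosonUp_ket] at h2
  rw [LinearMap.sub_apply, LinearMap.smul_apply, Module.End.mul_apply, sub_add_cancel] at h1
  change NeveuSchwarz.lOp κ _ v - _ • bosonUp 0 (bosonUp i v) ∈ _ at h1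
  have h3 := add_mem (fockLE_mono (w' := Occ.wt (μ, S) - 1 + upWt i + 2) (by omega) h1)
    (Submodule.smul_mem _ ξ h2)
  rw [hwt]
  convert h3 using 1
  · congr 1; ring
  · rw [smul_sub, smul_smul]; abel

theorem HasLead.gOp {κ : ℂ} {k : ℤ} (hk : k ≤ -2) {v : Fock} {μ : ℕ →₀ ℕ} {S : Finset ℕ}
    (h : HasLead v (μ, S)) (hS : (-k - 2).toNat ∉ S) : HasLead (gOp κ k v)
      (μ + Finsupp.single 0 1, insert (-k - 2).toNat S) := by
  obtain ⟨c, hc, hr⟩ := id h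
  obtain ⟨i, rfl⟩ : ∃ i : ℕ, k = Int.negSucc i - 1 := ⟨(-k - 2).toNat, by
    rw [Int.negSucc_eq]; omega⟩
  have hi : (-(Int.negSucc i - 1) - 2).toNat = i := by rw [Int.negSucc_eq]; omega
  rw [hi] at hS ⊢
  refine ⟨c * jwSign i S, mul_ne_zero hc (jwSign_ne_zero _ _), ?_⟩
  have hwt : Occ.wt (μ + Finsupp.single 0 1, insert i S) = Occ.wt (μ, S) + 3 := by
    rw [wt_insert _ hS, wt_add_single, upWt, if_pos rfl]; ring
  have h1 := gOp_lead κ _ h.mem (Or.inl ⟨hk, rfl⟩)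
  have h2 : bosonUp 0 (fermionUp i (v - c • ket (μ, S))) ∈
      fockLE (Occ.wt (μ, S) - 1 + 1 + 2) := raises_bosonUp 0 _ _ (raises_fermionUp i _ _ hr)
  rw [map_sub, map_sub, map_smul, map_smul, fermionUp_ket, if_neg hS, map_smul, bosonUp_ket] at h2
  rw [sub_add_cancel] at h1
  change NeveuSchwarz.gOp κ _ v - bosonUp 0 (fermionUp i v) ∈ _ at h1
  have h3 := add_mem h1 (fockLE_mono (w' := Occ.wt (μ, S) + 2) (by omega) h2)
  rw [hwt]
  convert h3 using 1
  · congr 1; ring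
  · rw [smul_smul]; abel

theorem linearIndependent_of_hasLead {ι : Type*} {v : ι → Fock} {b : ι → Occ}
    (hb : Function.Injective b) (h : ∀ i, HasLead (v i) (b i)) : LinearIndependent ℂ v := by
  rw [linearIndependent_iff']
  intro s g hg i hi
  by_contra hne
  obtain ⟨j, hj, hmax⟩ := Finset.exists_max_image (s.filter fun i => g i ≠ 0)
    (fun i => (b i).wt) ⟨i, Finset.mem_filter.mpr ⟨hi, hne⟩⟩
  obtain ⟨hjs, hgj⟩ := Finset.mem_filter.mp hj
  have hcoef : ∀ i, (b i).wt ≤ (b j).wt → i ≠ j → ket.repr (v i) (b j) = 0 := by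
    intro i hle hij
    obtain ⟨c, -, hr⟩ := h i
    have h1 := mem_fockLE_iff.mp hr (b j) (by omega)
    rw [map_sub, map_smul, ket.repr_self, Finsupp.sub_apply, Finsupp.smul_apply,
      Finsupp.single_eq_of_ne (fun h => hij (hb h.symm)), smul_zero, sub_zero] at h1
    exact h1
  have hcoefj : ket.repr (v j) (b j) ≠ 0 := by
    obtain ⟨c, hc, hr⟩ := h j
    have h1 := mem_fockLE_iff.mp hr (b j) (by omega)
    rw [map_sub, map_smul, ket.repr_self, Finsupp.sub_apply, Finsupp.smul_apply,
      Finsupp.single_eq_same, smul_eq_mul, mul_one, sub_eq_zero] at h1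
    rwa [h1]
  have h2 := congrArg (fun x => ket.repr x (b j)) hg
  simp only [map_sum, map_smul, Finsupp.coe_finsetSum, Finset.sum_apply, Finsupp.smul_apply,
    map_zero, Finsupp.coe_zero, Pi.zero_apply] at h2
  rw [Finset.sum_eq_single j] at h2
  · exact hcoefj ((smul_eq_zero.mp h2).resolve_left hgj)
  · intro i hi hij
    by_cases h0 : g i = 0
    · rw [h0, zero_smul]
    · rw [hcoef i (hmax i (Finset.mem_filter.mpr ⟨hi, h0⟩)) hij, smul_zero]
  · intro h; exact absurd hjs h

/-- The occupation numbers of the leading term of a monomial on the vacuum: every factor contributes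
`a_{-1}`, a factor `L_n` also `a_{n+1}`, and a factor `G_r` also `ψ_{r+1}`. -/
noncomputable def MonIndex.occ (I : MonIndex) : Occ :=
  (Multiset.toFinsupp ((I.ls.map fun n => (-n - 2).toNat : List ℕ) : Multiset ℕ) +
    Finsupp.single 0 (I.gs.length + I.ls.length), (I.gs.map fun k => (-k - 2).toNat).toFinset)

theorem hasLead_ls (κ : ℂ) (ls : List ℤ) (hls : ∀ n ∈ ls, n ≤ -2) :
    HasLead (fockRep κ (ls.map L).prod vacuum)
      (Multiset.toFinsupp ((ls.map fun n => (-n - 2).toNat : List ℕ) : Multiset ℕ) +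
        Finsupp.single 0 ls.length, ∅) := by
  induction ls with
  | nil => simpa using hasLead_vacuum
  | cons n ls ih =>
    have h := (ih fun m hm => hls m (List.mem_cons_of_mem _ hm)).lOp (κ := κ)
      (hls n List.mem_cons_self)
    rw [List.map_cons, List.prod_cons, map_mul, fockRep_L, Module.End.mul_apply]
    convert h using 2
    rw [List.map_cons, ← Multiset.cons_coe, ← Multiset.singleton_add, Multiset.toFinsupp_add,
      Multiset.toFinsupp_singleton, List.length_cons, Finsupp.single_add]
    abel

theorem hasLead_mon (κ : ℂ) (I : MonIndex) : HasLead (fockRep κ I.mon vacuum) I.occ := by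
  obtain ⟨gs, ls, hgs, hls, hg, -⟩ := I
  rw [MonIndex.mon, map_mul, Module.End.mul_apply, MonIndex.occ]
  simp only
  induction gs with
  | nil => simpa using hasLead_ls κ ls hls
  | cons k gs ih =>
    have h := (ih (fun m hm => hgs m (List.mem_cons_of_mem _ hm)) hg.of_cons).gOp (κ := κ)
      (hgs k List.mem_cons_self) (by
        simp only [List.mem_toFinset, List.mem_map, not_exists, not_and]
        intro m hm he
        have h1 := List.rel_of_pairwise_cons hg hm
        have h2 := hgs k List.mem_cons_self
        omega)
    rw [List.map_cons, List.prod_cons, map_mul, fockRep_G, Module.End.mul_apply]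
    convert h using 2
    · rw [List.length_cons, show gs.length + 1 + ls.length = gs.length + ls.length + 1 by ring,
        Finsupp.single_add, add_assoc]
    · rw [List.map_cons, List.toFinset_cons]

theorem MonIndex.ext' {I J : MonIndex} (h1 : I.gs = J.gs) (h2 : I.ls = J.ls) : I = J := by
  cases I; cases J; cases h1; cases h2; rfl

theorem degree_toFinsupp (s : Multiset ℕ) : (Multiset.toFinsupp s).degree = s.card := by
  induction s using Multiset.induction with
  | empty => simp
  | cons a s ih =>
    rw [← Multiset.singleton_add, Multiset.toFinsupp_add, map_add, ih,
      Multiset.toFinsupp_singleton, Finsupp.degree_single, Multiset.card_add,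
      Multiset.card_singleton]

theorem MonIndex.gs_nodup (I : MonIndex) : I.gs.Nodup := I.gs_desc.imp fun h => ne_of_gt h

theorem MonIndex.occ_injective : Function.Injective MonIndex.occ := by
  intro I J h
  obtain ⟨h1, h2⟩ := Prod.mk.inj h
  have hgs : I.gs = J.gs := by
    have key : ∀ {I J : MonIndex}, (I.gs.map fun k => (-k - 2).toNat).toFinset =
        (J.gs.map fun k => (-k - 2).toNat).toFinset → ∀ k ∈ I.gs, k ∈ J.gs := by
      intro I J h k hk
      have h3 : (-k - 2).toNat ∈ (I.gs.map fun k => (-k - 2).toNat).toFinset :=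
        List.mem_toFinset.mpr (List.mem_map_of_mem hk)
      rw [h, List.mem_toFinset, List.mem_map] at h3
      obtain ⟨m, hm, he⟩ := h3
      have := I.gs_le k hk
      have := J.gs_le m hm
      rwa [show k = m by omega]
    refine List.Perm.eq_of_pairwise (le := (· > ·)) ?_ I.gs_desc J.gs_desc
      ((List.perm_ext_iff_of_nodup I.gs_nodup J.gs_nodup).mpr fun k => ⟨key h2 k, key h2.symm k⟩)
    intro a b _ _ h3 h4
    exact absurd h3 (lt_asymm h4)
  have hlen : I.ls.length = J.ls.length := by
    have h3 := congrArg Finsupp.degree h1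
    simp only [map_add, degree_toFinsupp, Multiset.coe_card, List.length_map,
      Finsupp.degree_single, hgs] at h3
    omega
  rw [hgs, hlen] at h1
  have h3 := Multiset.toFinsupp.injective (add_right_cancel h1)
  have h4 := (Multiset.coe_eq_coe.mp h3).map fun j : ℕ => -(j : ℤ) - 2
  have key : ∀ I : MonIndex, (I.ls.map fun n => (-n - 2).toNat).map (fun j : ℕ => -(j : ℤ) - 2) =
      I.ls := by
    intro I
    rw [List.map_map]
    conv_rhs => rw [← List.map_id I.ls]
    refine List.map_congr_left fun n hn => ?_
    have := I.ls_le n hn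
    simp only [Function.comp_apply, id]
    omega
  rw [key, key] at h4
  exact MonIndex.ext' hgs (h4.eq_of_pairwise (le := (· ≥ ·))
    (fun a b _ _ h5 h6 => le_antisymm h6 h5) I.ls_desc J.ls_desc)

/-- A factor `G_r` has weight `3`, and a factor `L_n` weight `3`, or `4` if `n = -2`. -/
theorem MonIndex.wt_occ_le (I : MonIndex) :
    I.occ.wt ≤ 3 * I.gs.length + 4 * I.ls.length := by
  have h1 : (I.gs.map fun k => (-k - 2).toNat).toFinset.card ≤ I.gs.length := by
    simpa using List.toFinset_card_le (I.gs.map fun k => (-k - 2).toNat)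
  have h2 : Multiset.toFinsupp ((I.ls.map fun n => (-n - 2).toNat : List ℕ) : Multiset ℕ) 0 ≤
      I.ls.length := by
    rw [Multiset.toFinsupp_apply, Multiset.coe_count]
    simpa using List.count_le_length (a := 0) (l := I.ls.map fun n => (-n - 2).toNat)
  unfold Occ.wt MonIndex.occ
  simp only [map_add, degree_toFinsupp, Multiset.coe_card, List.length_map,
    Finsupp.degree_single, Finsupp.add_apply, Finsupp.single_eq_same]
  push_cast
  omega

/-! ### Ordered monomials span -/

theorem L_mul_L (m n : ℤ) : L m * L n = L n * L m + ((m : ℂ) - n) • L (m + n) +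
    (if m + n = 0 then ((m : ℂ) ^ 3 - m) / 12 else 0) • C := by
  have h := RingQuot.mkAlgHom_rel ℂ (Rel.LL m n)
  simp only [map_sub, map_mul, map_add, map_smul] at h
  rw [add_assoc, add_comm (L n * L m)]
  exact sub_eq_iff_eq_add.mp h

theorem L_mul_G (m k : ℤ) :
    L m * G k = G k * L m + ((m : ℂ) / 2 - ((k : ℂ) + 1 / 2)) • G (m + k) := by
  have h := RingQuot.mkAlgHom_rel ℂ (Rel.LG m k)
  simp only [map_sub, map_mul, map_smul] at h
  rw [add_comm (G k * L m)]
  exact sub_eq_iff_eq_add.mp h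

theorem G_mul_G (j k : ℤ) : G j * G k = -(G k * G j) + (2 : ℂ) • L (j + k + 1) +
    (if j + k + 1 = 0 then (((j : ℂ) + 1 / 2) ^ 2 - 1 / 4) / 3 else 0) • C := by
  have h := RingQuot.mkAlgHom_rel ℂ (Rel.GG j k)
  simp only [map_mul, map_add, map_smul] at h
  rw [add_assoc, neg_add_eq_sub]
  exact eq_sub_of_add_eq h

theorem C_mul_L (n : ℤ) : C * L n = L n * C := by
  have h := RingQuot.mkAlgHom_rel ℂ (Rel.CL n)
  rw [map_mul, map_mul] at h
  exact h

theorem C_mul_G (k : ℤ) : C * G k = G k * C := by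
  have h := RingQuot.mkAlgHom_rel ℂ (Rel.CG k)
  rw [map_mul, map_mul] at h
  exact h

theorem G_mul_L (k m : ℤ) :
    G k * L m = L m * G k + (((k : ℂ) + 1 / 2) - (m : ℂ) / 2) • G (m + k) := by
  rw [L_mul_G]; module

theorem G_mul_self {k : ℤ} : G k * G k = L (2 * k + 1) := by
  have h := G_mul_G k k
  rw [if_neg (by omega), zero_smul, add_zero, show k + k + 1 = 2 * k + 1 by ring] at h
  have h2 : (2 : ℂ) • (G k * G k) = (2 : ℂ) • L (2 * k + 1) := by
    rw [two_smul]; nth_rewrite 2 [h]; abel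
  exact smul_right_injective U (two_ne_zero (α := ℂ)) h2

/-- The element of the enveloping algebra belonging to a generator. -/
noncomputable def gen : Gen → U
  | Gen.L n => L n
  | Gen.G k => G k
  | Gen.C => C

/-- The generators `L_n` with `n ≤ -2` and `G_r` with `r ≤ -3/2`, of which the monomials are
built. -/
def Gen.IsNeg : Gen → Prop
  | Gen.L n => n ≤ -2
  | Gen.G k => k ≤ -2
  | Gen.C => False

/-- Two generators commute or anticommute up to one generator and a multiple of the central one. For
two generators that occur in monomials the correction is again such a generator, and the central
term is absent, the sum of their indices being negative. -/
theorem exists_gen_mul_gen (x y : Gen) : ∃ (ε s t : ℂ) (z : Gen),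
    gen x * gen y = ε • (gen y * gen x) + s • gen z + t • gen Gen.C ∧
      (x.IsNeg → y.IsNeg → z.IsNeg ∧ t = 0) := by
  have central : gen x * gen y = gen y * gen x → (x = Gen.C ∨ y = Gen.C) →
      ∃ (ε s t : ℂ) (z : Gen), gen x * gen y = ε • (gen y * gen x) + s • gen z + t • gen Gen.C ∧
        (x.IsNeg → y.IsNeg → z.IsNeg ∧ t = 0) := fun h hC =>
    ⟨1, 0, 0, Gen.C, by rw [zero_smul, add_zero, add_zero, one_smul, h], fun h1 h2 => by
      rcases hC with rfl | rfl
      · exact h1.elim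
      · exact h2.elim⟩
  rcases x with m | j | _ <;> rcases y with n | k | _
  · refine ⟨1, (m : ℂ) - n, _, Gen.L (m + n),
      (one_smul ℂ (L n * L m)).symm ▸ L_mul_L m n, fun h1 h2 => ?_⟩
    simp only [Gen.IsNeg] at h1 h2 ⊢
    exact ⟨by omega, if_neg (by omega)⟩
  · refine ⟨1, (m : ℂ) / 2 - ((k : ℂ) + 1 / 2), 0, Gen.G (m + k), ?_, fun h1 h2 => ?_⟩
    · rw [zero_smul, add_zero, one_smul]; exact L_mul_G m k
    · simp only [Gen.IsNeg] at h1 h2 ⊢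
      exact ⟨by omega, trivial⟩
  · exact central (C_mul_L m).symm (Or.inr rfl)
  · refine ⟨1, ((j : ℂ) + 1 / 2) - (n : ℂ) / 2, 0, Gen.G (n + j), ?_, fun h1 h2 => ?_⟩
    · rw [zero_smul, add_zero, one_smul]; exact G_mul_L j n
    · simp only [Gen.IsNeg] at h1 h2 ⊢
      exact ⟨by omega, trivial⟩
  · refine ⟨-1, 2, if j + k + 1 = 0 then (((j : ℂ) + 1 / 2) ^ 2 - 1 / 4) / 3 else 0,
      Gen.L (j + k + 1), ?_, fun h1 h2 => ?_⟩
    · refine (G_mul_G j k).trans ?_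
      congr 2
    · simp only [Gen.IsNeg] at h1 h2 ⊢
      exact ⟨by omega, if_neg (by omega)⟩
  · exact central (C_mul_G j).symm (Or.inr rfl)
  · exact central (C_mul_L n) (Or.inl rfl)
  · exact central (C_mul_G k) (Or.inl rfl)
  · exact central rfl (Or.inl rfl)

theorem exists_sorted_perm (l : List Gen) (hl : ∀ g ∈ l, g.IsNeg) :
    ∃ gs ls : List ℤ, l.Perm (gs.map Gen.G ++ ls.map Gen.L) ∧ gs.Pairwise (· ≥ ·) ∧
      ls.Pairwise (· ≥ ·) := by
  have h : ∃ gs ls : List ℤ, l.Perm (gs.map Gen.G ++ ls.map Gen.L) := by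
    induction l with
    | nil => exact ⟨[], [], by simp⟩
    | cons x l ih =>
      obtain ⟨gs, ls, h⟩ := ih fun g hg => hl g (List.mem_cons_of_mem _ hg)
      rcases x with n | k | _
      · exact ⟨gs, n :: ls, (h.cons _).trans List.perm_middle.symm⟩
      · exact ⟨k :: gs, ls, h.cons _⟩
      · exact (hl Gen.C List.mem_cons_self).elim
  obtain ⟨gs, ls, h⟩ := h
  refine ⟨gs.insertionSort (· ≥ ·), ls.insertionSort (· ≥ ·), h.trans ?_,
    List.pairwise_insertionSort _ _, List.pairwise_insertionSort _ _⟩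
  exact ((List.perm_insertionSort _ gs).symm.map _).append
    ((List.perm_insertionSort _ ls).symm.map _)

section Words

variable {M : Type*} [AddCommGroup M] [Module U M] [Module ℂ M]

/-- The span of the vectors obtained from `v` by applying fewer than `d` of the generators that
occur in monomials, in any order. The strict bound makes `d = 0` the zero space. -/
noncomputable def wordSpan (v : M) (d : ℕ) : Submodule ℂ M :=
  Submodule.span ℂ {x | ∃ l : List Gen, (∀ g ∈ l, g.IsNeg) ∧ l.length < d ∧
    x = (l.map gen).prod • v}

/-- The properties of the highest weight vector of `V'_{p,q}` used for straightening: it is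
killed by `L_n` with `n ≥ -1` and by `G_r` with `r ≥ -1/2`, and the central element acts on it by a
scalar. -/
structure IsVacuumLike (v : M) : Prop where
  L_smul : ∀ n : ℤ, -1 ≤ n → L n • v = 0
  G_smul : ∀ k : ℤ, -1 ≤ k → G k • v = 0
  C_smul : ∃ c : ℂ, C • v = c • v

theorem word_mem_wordSpan (v : M) {l : List Gen} (hl : ∀ g ∈ l, g.IsNeg) {d : ℕ}
    (hd : l.length < d) : (l.map gen).prod • v ∈ wordSpan v d :=
  Submodule.subset_span ⟨l, hl, hd, rfl⟩

theorem wordSpan_mono (v : M) {d d' : ℕ} (h : d ≤ d') : wordSpan v d ≤ wordSpan v d' :=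
  Submodule.span_mono fun _ ⟨l, hl, hd, hx⟩ => ⟨l, hl, hd.trans_le h, hx⟩

/-- The span of the ordered monomials with fewer than `d` factors, applied to `v`. -/
noncomputable def monSpan (v : M) (d : ℕ) : Submodule ℂ M :=
  Submodule.span ℂ {x | ∃ I : MonIndex, I.gs.length + I.ls.length < d ∧ x = I.mon • v}

theorem monSpan_mono (v : M) {d d' : ℕ} (h : d ≤ d') : monSpan v d ≤ monSpan v d' :=
  Submodule.span_mono fun _ ⟨I, hd, hx⟩ => ⟨I, hd.trans_le h, hx⟩

theorem mon_mem_wordSpan (v : M) (I : MonIndex) {d : ℕ} (hd : I.gs.length + I.ls.length < d) :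
    I.mon • v ∈ wordSpan v d := by
  have hI : I.mon = ((I.gs.map Gen.G ++ I.ls.map Gen.L).map gen).prod := by
    rw [List.map_append, List.map_map, List.map_map, List.prod_append]; rfl
  rw [hI]
  refine word_mem_wordSpan v ?_ (by simpa using hd)
  intro g hg
  rcases List.mem_append.mp hg with hg | hg
  · obtain ⟨k, hk, rfl⟩ := List.mem_map.mp hg
    exact I.gs_le k hk
  · obtain ⟨n, hn, rfl⟩ := List.mem_map.mp hg
    exact I.ls_le n hn

theorem monSpan_le_wordSpan (v : M) (d : ℕ) : monSpan v d ≤ wordSpan v d :=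
  Submodule.span_le.mpr fun _ ⟨I, hd, hx⟩ => hx ▸ mon_mem_wordSpan v I hd

variable [IsScalarTower ℂ U M]

theorem smul_comm_complex (a : ℂ) (u : U) (x : M) : u • a • x = a • u • x := by
  rw [← smul_one_smul U a x, smul_smul, mul_smul_comm, mul_one, smul_assoc]

theorem smul_mem_of_words (v : M) (u : U) {d : ℕ} {W : Submodule ℂ M}
    (h : ∀ l : List Gen, (∀ g ∈ l, g.IsNeg) → l.length < d → u • (l.map gen).prod • v ∈ W)
    {x : M} (hx : x ∈ wordSpan v d) : u • x ∈ W := by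
  induction hx using Submodule.span_induction with
  | mem x hx => obtain ⟨l, hl, hd, rfl⟩ := hx; exact h l hl hd
  | zero => rw [smul_zero]; exact zero_mem _
  | add x y _ _ hx hy => rw [smul_add]; exact add_mem hx hy
  | smul a x _ hx => rw [smul_comm_complex]; exact Submodule.smul_mem _ a hx

theorem neg_smul_mem_wordSpan (v : M) {g : Gen} (hg : g.IsNeg) {d : ℕ} {x : M}
    (hx : x ∈ wordSpan v d) : gen g • x ∈ wordSpan v (d + 1) := by
  refine smul_mem_of_words v (gen g) (fun l hl hd => ?_) hx
  rw [smul_smul, ← List.prod_cons, ← List.map_cons]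
  exact word_mem_wordSpan v (by simpa using ⟨hg, hl⟩) (by simpa using hd)

/-- A generator that does not occur in monomials preserves the filtration by word length: moved to
the right, it leaves words in which it has replaced a letter, and in the end it acts on `v`. -/
theorem nonneg_smul_mem_wordSpan {v : M} (hv : IsVacuumLike v) {g : Gen} (hg : ¬ g.IsNeg) {d : ℕ}
    {x : M} (hx : x ∈ wordSpan v d) : gen g • x ∈ wordSpan v d := by
  refine smul_mem_of_words v (gen g) (fun l hl hd => ?_) hx
  clear hx x
  induction l generalizing g d with
  | nil =>
    rw [List.map_nil, List.prod_nil, one_smul]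
    rcases g with n | k | _
    · simp only [Gen.IsNeg] at hg
      rw [gen, hv.L_smul n (by omega)]; exact zero_mem _
    · simp only [Gen.IsNeg] at hg
      rw [gen, hv.G_smul k (by omega)]; exact zero_mem _
    · obtain ⟨c, hc⟩ := hv.C_smul
      rw [gen, hc]
      exact Submodule.smul_mem _ _ (by simpa using word_mem_wordSpan v (l := []) (by simp) hd)
  | cons y l ih =>
    obtain ⟨ε, s, t, z, h, -⟩ := exists_gen_mul_gen g y
    obtain ⟨d, rfl⟩ : ∃ d', d = d' + 1 :=
      Nat.exists_eq_add_one_of_ne_zero (by rintro rfl; simp at hd)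
    have hl' : ∀ g ∈ l, g.IsNeg := fun g hg => hl g (List.mem_cons_of_mem _ hg)
    have hd' : l.length < d := by simpa using hd
    have hy := hl y List.mem_cons_self
    rw [List.map_cons, List.prod_cons, mul_smul, ← mul_smul (gen g), h, add_smul, add_smul,
      smul_assoc, smul_assoc, smul_assoc, mul_smul]
    refine add_mem (add_mem ?_ ?_) ?_ <;> apply Submodule.smul_mem
    · exact neg_smul_mem_wordSpan v hy (ih hg hl' hd')
    · by_cases hz : z.IsNeg
      · exact neg_smul_mem_wordSpan v hz (word_mem_wordSpan v hl' hd')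
      · exact wordSpan_mono v (Nat.le_succ d) (ih hz hl' hd')
    · exact wordSpan_mono v (Nat.le_succ d) (ih (g := Gen.C) (fun h => h) hl' hd')

theorem smul_mem_wordSpan {v : M} (hv : IsVacuumLike v) (g : Gen) {d : ℕ} {x : M}
    (hx : x ∈ wordSpan v d) : gen g • x ∈ wordSpan v (d + 1) := by
  by_cases hg : g.IsNeg
  · exact neg_smul_mem_wordSpan v hg hx
  · exact wordSpan_mono v (Nat.le_succ d) (nonneg_smul_mem_wordSpan hv hg hx)

theorem exists_mem_wordSpan {v : M} (hv : IsVacuumLike v) (u : U) : ∃ d, u • v ∈ wordSpan v d := by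
  have key : ∀ a : FreeAlgebra ℂ Gen, ∀ d, ∀ x ∈ wordSpan v d,
      ∃ d', RingQuot.mkAlgHom ℂ Rel a • x ∈ wordSpan v d' := by
    intro a
    induction a using FreeAlgebra.induction with
    | grade0 r =>
      intro d x hx
      refine ⟨d, ?_⟩
      rw [AlgHom.commutes, algebraMap_smul]
      exact Submodule.smul_mem _ _ hx
    | grade1 g =>
      intro d x hx
      refine ⟨d + 1, ?_⟩
      have := smul_mem_wordSpan hv g hx
      cases g <;> exact this
    | mul a b ha hb =>
      intro d x hx
      obtain ⟨d', h'⟩ := hb d x hx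
      rw [map_mul, mul_smul]
      exact ha d' _ h'
    | add a b ha hb =>
      intro d x hx
      obtain ⟨d', h'⟩ := ha d x hx
      obtain ⟨d'', h''⟩ := hb d x hx
      refine ⟨max d' d'', ?_⟩
      rw [map_add, add_smul]
      exact add_mem (wordSpan_mono v (le_max_left _ _) h') (wordSpan_mono v (le_max_right _ _) h'')
  obtain ⟨a, rfl⟩ := RingQuot.mkAlgHom_surjective ℂ Rel u
  exact key a 1 v (by simpa using word_mem_wordSpan v (l := []) (by simp) (Nat.zero_lt_one))

/-- Permuting the letters of a word changes it by a sign and by shorter words. -/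
theorem word_perm (v : M) {l₁ l₂ : List Gen} (h : l₁.Perm l₂) (hl : ∀ g ∈ l₁, g.IsNeg) :
    ∃ ε : ℂ, (l₁.map gen).prod • v - ε • (l₂.map gen).prod • v ∈ wordSpan v l₁.length := by
  induction h with
  | nil => exact ⟨1, by rw [one_smul, sub_self]; exact zero_mem _⟩
  | cons x h ih =>
    obtain ⟨ε, hε⟩ := ih fun g hg => hl g (List.mem_cons_of_mem _ hg)
    refine ⟨ε, ?_⟩
    have := neg_smul_mem_wordSpan v (hl x List.mem_cons_self) hε
    rwa [smul_sub, smul_comm_complex, smul_smul, smul_smul] at this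
  | swap x y l =>
    obtain ⟨ε, s, t, z, h, hneg⟩ := exists_gen_mul_gen y x
    obtain ⟨hz, rfl⟩ := hneg (hl y (by simp)) (hl x (by simp))
    refine ⟨ε, ?_⟩
    have hzl : ∀ g ∈ z :: l, g.IsNeg := by
      intro g hg
      rcases List.mem_cons.mp hg with rfl | hg
      · exact hz
      · exact hl g (by simp [hg])
    have := Submodule.smul_mem _ s
      (word_mem_wordSpan v hzl (d := (y :: x :: l).length) (by simp))
    convert this using 1
    simp only [List.map_cons, List.prod_cons]
    rw [← mul_assoc, h, zero_smul, add_zero, add_mul, add_smul, smul_mul_assoc, smul_mul_assoc,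
      smul_assoc, smul_assoc, mul_assoc, add_sub_cancel_left]
  | trans h₁ h₂ ih₁ ih₂ =>
    obtain ⟨ε₁, hε₁⟩ := ih₁ hl
    obtain ⟨ε₂, hε₂⟩ := ih₂ fun g hg => hl g (h₁.mem_iff.mpr hg)
    refine ⟨ε₁ * ε₂, ?_⟩
    rw [← h₁.length_eq] at hε₂
    have := add_mem hε₁ (Submodule.smul_mem _ ε₁ hε₂)
    convert this using 1
    rw [smul_sub, smul_smul]; abel

/-- Straightening: modulo shorter words a word can be sorted. If an odd letter occurs twice, the two
occurrences are brought together and shorten by `G_r² = L_{2r}`. -/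
theorem wordSpan_le_monSpan (v : M) (d : ℕ) : wordSpan v d ≤ monSpan v d := by
  induction d with
  | zero => exact Submodule.span_le.mpr fun x ⟨l, _, hd, _⟩ => absurd hd (Nat.not_lt_zero _)
  | succ d ih =>
    refine Submodule.span_le.mpr ?_
    rintro x ⟨l, hl, hd, rfl⟩
    rcases (Nat.lt_succ_iff.mp hd).lt_or_eq with hlt | heq
    · exact monSpan_mono v (Nat.le_succ d) (ih (word_mem_wordSpan v hl hlt))
    obtain ⟨gs, ls, hp, hgs, hls⟩ := exists_sorted_perm l hl
    have hG : ∀ k ∈ gs, k ≤ -2 := fun k hk =>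
      hl (Gen.G k) (hp.mem_iff.mpr (List.mem_append_left _ (List.mem_map_of_mem hk)))
    have hL : ∀ n ∈ ls, n ≤ -2 := fun n hn =>
      hl (Gen.L n) (hp.mem_iff.mpr (List.mem_append_right _ (List.mem_map_of_mem hn)))
    by_cases hnd : gs.Nodup
    · obtain ⟨ε, hε⟩ := word_perm v hp hl
      have h1 := monSpan_mono v (Nat.le_succ d) (ih (heq ▸ hε))
      let I : MonIndex := ⟨gs, ls, hG, hL,
        (hgs.and hnd).imp fun h => lt_of_le_of_ne h.1 h.2.symm, hls⟩
      have hI : ((gs.map Gen.G ++ ls.map Gen.L).map gen).prod • v = I.mon • v := by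
        rw [List.map_append, List.map_map, List.map_map, List.prod_append]; rfl
      have hlen : gs.length + ls.length = d := by
        rw [← heq, hp.length_eq]; simp
      have h2 : I.mon • v ∈ monSpan v (d + 1) :=
        Submodule.subset_span ⟨I, by simp only [I]; omega, rfl⟩
      have h3 := add_mem h1 (Submodule.smul_mem _ ε h2)
      rw [hI, sub_add_cancel] at h3
      exact h3
    · obtain ⟨k, hk⟩ := List.exists_duplicate_iff_not_nodup.mpr hnd
      obtain ⟨r, hr⟩ := (List.duplicate_iff_sublist.mp hk).exists_perm_append
      have hp2 : l.Perm (Gen.G k :: Gen.G k :: (r.map Gen.G ++ ls.map Gen.L)) := by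
        refine hp.trans (((hr.map Gen.G).append_right _).trans ?_)
        simp
      obtain ⟨ε, hε⟩ := word_perm v hp2 hl
      have hk2 : k ≤ -2 := hl (Gen.G k) (hp2.mem_iff.mpr List.mem_cons_self)
      have h2 : ((Gen.G k :: Gen.G k :: (r.map Gen.G ++ ls.map Gen.L)).map gen).prod • v ∈
          wordSpan v d := by
        have : ((Gen.G k :: Gen.G k :: (r.map Gen.G ++ ls.map Gen.L)).map gen).prod =
            ((Gen.L (2 * k + 1) :: (r.map Gen.G ++ ls.map Gen.L)).map gen).prod := by
          simp only [List.map_cons, List.prod_cons]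
          rw [← mul_assoc]
          congr 1
          exact G_mul_self
        rw [this]
        refine word_mem_wordSpan v ?_ ?_
        · intro g hg
          rcases List.mem_cons.mp hg with rfl | hg
          · simp only [Gen.IsNeg]; omega
          · exact hl g (hp2.mem_iff.mpr (by simp only [List.mem_cons]; tauto))
        · have := hp2.length_eq
          simp only [List.length_cons] at this ⊢
          omega
      have h3 := add_mem (heq ▸ hε) (Submodule.smul_mem _ ε h2)
      rw [sub_add_cancel] at h3
      exact monSpan_mono v (Nat.le_succ d) (ih h3)

/-- The degree of a monomial, which is its `L_0`-eigenvalue. -/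
noncomputable def MonIndex.level (I : MonIndex) : ℂ :=
  (I.gs.map fun k : ℤ => -((k : ℂ) + 1 / 2)).sum + (I.ls.map fun n : ℤ => -(n : ℂ)).sum

theorem L_zero_smul_mon {v : M} (hv : IsVacuumLike v) (I : MonIndex) :
    L 0 • I.mon • v = I.level • I.mon • v := by
  have hls : ∀ ls : List ℤ, L 0 • (ls.map L).prod • v =
      (ls.map fun n : ℤ => -(n : ℂ)).sum • (ls.map L).prod • v := by
    intro ls
    induction ls with
    | nil => simp [hv.L_smul 0 (by norm_num)]
    | cons n ls ih =>
      have h := L_mul_L 0 n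
      rw [zero_add,
        show (if n = 0 then (((0 : ℤ) : ℂ) ^ 3 - ((0 : ℤ) : ℂ)) / 12 else 0) = 0 by simp,
        zero_smul, add_zero] at h
      rw [List.map_cons, List.prod_cons, List.map_cons, List.sum_cons, mul_smul,
        ← mul_smul (L 0), h, add_smul, mul_smul, ih, smul_comm_complex, smul_assoc]
      rw [← add_smul]
      congr 1
      push_cast
      ring
  have hgs : ∀ (gs : List ℤ) (a : ℂ) (x : M), L 0 • x = a • x → L 0 • (gs.map G).prod • x =
      ((gs.map fun k : ℤ => -((k : ℂ) + 1 / 2)).sum + a) • (gs.map G).prod • x := by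
    intro gs a x hx
    induction gs with
    | nil => simp [hx]
    | cons k gs ih =>
      have h := L_mul_G 0 k
      rw [zero_add] at h
      rw [List.map_cons, List.prod_cons, List.map_cons, List.sum_cons, mul_smul,
        ← mul_smul (L 0), h, add_smul, mul_smul, ih, smul_comm_complex, smul_assoc]
      rw [← add_smul]
      congr 1
      push_cast
      ring
  rw [MonIndex.mon, mul_smul, hgs _ _ _ (hls I.ls), MonIndex.level]

end Words

/-! ### Monomials of given degree with many factors -/

theorem MonIndex.level_eq (I : MonIndex) : I.level =
    (((I.gs.map fun k => -2 * k - 1).sum + 2 * (I.ls.map fun n => -n).sum : ℤ) : ℂ) / 2 := by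
  have h1 : ∀ gs : List ℤ, (gs.map fun k : ℤ => -((k : ℂ) + 1 / 2)).sum =
      (((gs.map fun k => -2 * k - 1).sum : ℤ) : ℂ) / 2 := by
    intro gs
    induction gs with
    | nil => simp
    | cons k gs ih =>
      rw [List.map_cons, List.sum_cons, ih, List.map_cons, List.sum_cons]; push_cast; ring
  have h2 : ∀ ls : List ℤ, (ls.map fun n : ℤ => -(n : ℂ)).sum =
      (((ls.map fun n => -n).sum : ℤ) : ℂ) := by
    intro ls
    induction ls with
    | nil => simp
    | cons n ls ih =>
      rw [List.map_cons, List.sum_cons, ih, List.map_cons, List.sum_cons]; push_cast; ring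
  rw [MonIndex.level, h1, h2]; push_cast; ring

theorem two_mul_length_le_sum_neg (ls : List ℤ) (h : ∀ n ∈ ls, n ≤ -2) :
    2 * (ls.length : ℤ) ≤ (ls.map fun n => -n).sum ∧
      ((ls.map fun n => -n).sum = 2 * (ls.length : ℤ) → ls = List.replicate ls.length (-2)) := by
  induction ls with
  | nil => simp
  | cons n ls ih =>
    obtain ⟨h1, h2⟩ := ih fun m hm => h m (List.mem_cons_of_mem _ hm)
    have h3 := h n List.mem_cons_self
    rw [List.map_cons, List.sum_cons, List.length_cons]
    push_cast
    refine ⟨by omega, fun h4 => ?_⟩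
    rw [List.replicate_succ, ← h2 (by omega), show n = -2 by omega]

theorem five_mul_length_le_sum (gs : List ℤ) (h : ∀ k ∈ gs, k ≤ -3) :
    5 * (gs.length : ℤ) ≤ (gs.map fun k => -2 * k - 1).sum := by
  induction gs with
  | nil => simp
  | cons k gs ih =>
    have h1 := ih fun m hm => h m (List.mem_cons_of_mem _ hm)
    have h3 := h k List.mem_cons_self
    rw [List.map_cons, List.sum_cons, List.length_cons]
    push_cast
    omega

/-- The index of the monomial `G_{-3/2} G_{-5/2} L_{-2}^k`. -/
def ggIndex (k : ℕ) : MonIndex where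
  gs := [-2, -3]
  ls := List.replicate k (-2)
  gs_le := by simp
  ls_le := by
    intro n hn
    exact (List.eq_of_mem_replicate hn).le
  gs_desc := by simp
  ls_desc := by simp [List.pairwise_replicate]

/-- A monomial of degree `N / 2` with at least `d` factors, where `4 d` is `N` or `N + 1`, is one of
`L_{-2}^d`, `G_{-3/2} G_{-5/2} L_{-2}^{d-2}` and `G_{-3/2} L_{-2}^{d-1}`. -/
theorem length_lt_or_eq_of_level {N : ℤ} {I : MonIndex} (hI : I.level = (N : ℂ) / 2) {d : ℕ}
    (hd : 4 * (d : ℤ) = N ∨ 4 * (d : ℤ) = N + 1) :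
    I.gs.length + I.ls.length < d ∨ (4 * (d : ℤ) = N ∧ (I = lIndex d ∨
      ∃ k, d = k + 2 ∧ I = ggIndex k)) ∨
    (4 * (d : ℤ) = N + 1 ∧ ∃ k, d = k + 1 ∧ I = glIndex k) := by
  rw [I.level_eq, div_left_inj' two_ne_zero, Int.cast_inj] at hI
  by_contra! hcon
  obtain ⟨hlen, h1, h2⟩ := hcon
  obtain ⟨h3, h4⟩ := two_mul_length_le_sum_neg I.ls I.ls_le
  set X := (I.ls.map fun n => -n).sum
  rcases hgs : I.gs with _ | ⟨a, _ | ⟨b, r⟩⟩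
  · rw [hgs] at hI hlen
    simp only [List.map_nil, List.sum_nil, List.length_nil] at hI hlen
    have h5 : I.ls.length = d := by omega
    exact (h1 (by omega)).1 (MonIndex.ext' hgs (by rw [h4 (by omega), h5]; rfl))
  · have ha : a ≤ -2 := I.gs_le a (by rw [hgs]; simp)
    rw [hgs] at hI hlen
    simp only [List.map_cons, List.map_nil, List.sum_cons, List.sum_nil, List.length_cons,
      List.length_nil] at hI hlen
    refine h2 (by omega) I.ls.length (by omega) (MonIndex.ext' ?_ (h4 (by omega)))
    rw [hgs, show a = -2 by omega]; rfl
  · have ha : a ≤ -2 := I.gs_le a (by rw [hgs]; simp)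
    have hdesc := I.gs_desc
    rw [hgs] at hdesc
    have hb : ∀ m ∈ b :: r, m ≤ -3 := fun m hm => by
      have := List.rel_of_pairwise_cons hdesc hm
      omega
    have hb' := hb b List.mem_cons_self
    have hr := five_mul_length_le_sum r fun m hm => hb m (List.mem_cons_of_mem _ hm)
    rw [hgs] at hI hlen
    simp only [List.map_cons, List.sum_cons, List.length_cons] at hI hlen
    have hr0 : r.length = 0 := by omega
    refine (h1 (by omega)).2 I.ls.length (by omega) (MonIndex.ext' ?_ (h4 (by omega)))
    rw [hgs, show a = -2 by omega, show b = -3 by omega, List.length_eq_zero_iff.mp hr0]; rfl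

theorem MonIndex.deg_apply_zero (I : MonIndex) :
    (ofLex I.deg) 0 = I.gs.length + I.ls.length := by
  rw [MonIndex.deg, ofLex_toLex, Finsupp.add_apply, Finsupp.single_eq_same,
    Multiset.toFinsupp_apply, Multiset.coe_count, List.count_eq_zero_of_not_mem, add_zero]
  simp only [List.mem_append, List.mem_map, not_or, not_exists, not_and]
  refine ⟨fun k hk => ?_, fun n hn => ?_⟩
  · have := I.gs_le k hk; omega
  · have := I.ls_le n hn; omega

theorem MonIndex.deg_apply_one_le (I : MonIndex) :
    (ofLex I.deg) 1 ≤ I.gs.length + I.ls.length := by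
  rw [MonIndex.deg, ofLex_toLex, Finsupp.add_apply, Finsupp.single_eq_of_ne one_ne_zero,
    Multiset.toFinsupp_apply, Multiset.coe_count, zero_add]
  refine List.count_le_length.trans ?_
  simp

theorem mon_lIndex (m : ℕ) : (lIndex m).mon = L (-2) ^ m := by
  simp [MonIndex.mon, lIndex]

theorem mon_glIndex (k : ℕ) : (glIndex k).mon = G (-2) * L (-2) ^ k := by
  simp [MonIndex.mon, glIndex]

theorem mon_ggIndex (k : ℕ) : (ggIndex k).mon = G (-2) * G (-3) * L (-2) ^ k := by
  simp [MonIndex.mon, ggIndex, mul_assoc]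

/-! ### The monomial basis -/

section Basis

variable {M : Type*} [AddCommGroup M] [Module U M] [Module ℂ M] {v : M} {κ : ℂ}
  {φ : M →ₗ[ℂ] Fock}

theorem linearIndependent_mon (hφ : ∀ (u : U) (x : M), φ (u • x) = fockRep κ u (φ x))
    (hφv : φ v = vacuum) :
    LinearIndependent ℂ fun I : MonIndex => I.mon • v := by
  refine LinearIndependent.of_comp φ
    (linearIndependent_of_hasLead MonIndex.occ_injective fun I => ?_)
  rw [Function.comp_apply, hφ, hφv]
  exact hasLead_mon κ I

theorem fockMap_mon_mem (hφ : ∀ (u : U) (x : M), φ (u • x) = fockRep κ u (φ x))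
    (hφv : φ v = vacuum) (I : MonIndex) :
    φ (I.mon • v) ∈ fockLE (3 * I.gs.length + 4 * I.ls.length) := by
  rw [hφ, hφv]
  exact fockLE_mono I.wt_occ_le (hasLead_mon κ I).mem

theorem fockMap_monSpan (hφ : ∀ (u : U) (x : M), φ (u • x) = fockRep κ u (φ x))
    (hφv : φ v = vacuum) {d : ℕ} {x : M} (hx : x ∈ monSpan v d) :
    φ x ∈ fockLE (4 * d - 4) := by
  have : monSpan v d ≤ (fockLE (4 * d - 4)).comap φ := by
    refine Submodule.span_le.mpr ?_
    rintro _ ⟨I, hI, rfl⟩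
    exact fockLE_mono (by omega) (fockMap_mon_mem hφ hφv I)
  exact this hx

variable [IsScalarTower ℂ U M]

theorem exists_finsupp_mon (hv : IsVacuumLike v) (u : U) :
    ∃ c : MonIndex →₀ ℂ, u • v = c.sum fun I a => a • I.mon • v := by
  obtain ⟨d, hd⟩ := exists_mem_wordSpan hv u
  have h1 : u • v ∈ Submodule.span ℂ (Set.range fun I : MonIndex => I.mon • v) :=
    Submodule.span_mono (by rintro _ ⟨I, -, rfl⟩; exact ⟨I, rfl⟩) (wordSpan_le_monSpan _ d hd)
  obtain ⟨c, hc⟩ := Finsupp.mem_span_range_iff_exists_finsupp.mp h1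
  exact ⟨c, hc.symm⟩

theorem fockMap_injective (hv : IsVacuumLike v) (hcyc : ∀ x : M, ∃ u : U, x = u • v)
    (hφ : ∀ (u : U) (x : M), φ (u • x) = fockRep κ u (φ x))
    (hφv : φ v = vacuum) : Function.Injective φ := by
  rw [injective_iff_map_eq_zero]
  intro x hx
  obtain ⟨u, rfl⟩ := hcyc x
  obtain ⟨c, hc⟩ := exists_finsupp_mon hv u
  rw [hc] at hx ⊢
  have hli : LinearIndependent ℂ fun I : MonIndex => fockRep κ I.mon vacuum :=
    linearIndependent_of_hasLead MonIndex.occ_injective fun I => hasLead_mon κ I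
  have h0 : c = 0 := by
    refine linearIndependent_iff.mp hli c ?_
    rw [Finsupp.linearCombination_apply, ← hx, map_finsuppSum]
    simp only [map_smul, hφ, hφv]
  rw [h0, Finsupp.sum_zero_index]

/-- An `L_0`-eigenvector is a combination of monomials of its degree. With any finite set `T` of
monomials singled out, the remaining ones have few factors if all others of that degree do. -/
theorem exists_decomposition (hv : IsVacuumLike v) (hcyc : ∀ x : M, ∃ u : U, x = u • v)
    (hli : LinearIndependent ℂ fun I : MonIndex => I.mon • v) {x : M} {N : ℂ}
    (hx : L 0 • x = N • x) : ∃ c : MonIndex → ℂ, ∀ (T : Finset MonIndex) (d : ℕ),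
      (∀ I : MonIndex, I.level = N → I ∉ T → I.gs.length + I.ls.length < d) →
      x - ∑ I ∈ T, c I • I.mon • v ∈ monSpan v d := by
  classical
  obtain ⟨u, rfl⟩ := hcyc x
  obtain ⟨c, hc⟩ := exists_finsupp_mon hv u
  rw [hc] at hx ⊢
  have hlev : ∀ I, c I ≠ 0 → I.level = N := by
    have h1 : (c.sum fun I a => (a * (I.level - N)) • I.mon • v) = 0 := by
      have h2 : L 0 • (c.sum fun I a => a • I.mon • v) =
          c.sum fun I a => (a * I.level) • I.mon • v := by
        rw [Finsupp.smul_sum]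
        refine Finsupp.sum_congr fun I _ => ?_
        rw [smul_comm_complex, L_zero_smul_mon hv, smul_smul]
      rw [h2, Finsupp.smul_sum, ← sub_eq_zero, ← Finsupp.sum_sub] at hx
      rw [← hx]
      refine Finsupp.sum_congr fun I _ => ?_
      rw [smul_smul, ← sub_smul]
      congr 1; ring
    intro I hI
    have h3 := linearIndependent_iff'.mp hli c.support (fun I => c I * (I.level - N)) h1 I
      (Finsupp.mem_support_iff.mpr hI)
    exact sub_eq_zero.mp ((mul_eq_zero.mp h3).resolve_left hI)
  refine ⟨c, fun T d hT => ?_⟩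
  rw [Finsupp.sum_of_support_subset c (Finset.subset_union_right (s₁ := T)) _ (by simp),
    ← Finset.sum_sdiff (Finset.subset_union_left (s₁ := T) (s₂ := c.support)),
    add_sub_cancel_right]
  refine sum_mem fun I hI => ?_
  by_cases h0 : c I = 0
  · rw [h0, zero_smul]; exact zero_mem _
  · exact Submodule.smul_mem _ _
      (Submodule.subset_span ⟨I, hT I (hlev I h0) (Finset.mem_sdiff.mp hI).2, rfl⟩)

end Basis

/-! ### The leading terms of singular vectors -/

section Leading

variable {M : Type*} [AddCommGroup M] [Module U M] [Module ℂ M] {v : M} {κ : ℂ}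
  {φ : M →ₗ[ℂ] Fock}

theorem L_pow_mem_wordSpan (v : M) {k d : ℕ} (h : k < d) : L (-2) ^ k • v ∈ wordSpan v d := by
  rw [← mon_lIndex]
  exact mon_mem_wordSpan v _ (by simpa [lIndex] using h)

theorem glIndex_notMem_monSpan (hli : LinearIndependent ℂ fun I : MonIndex => I.mon • v) (k : ℕ) :
    (glIndex k).mon • v ∉ monSpan v (k + 1) := by
  have h := hli.notMem_span_image (s := {I | I.gs.length + I.ls.length < k + 1}) (x := glIndex k)
    (by simp [glIndex])
  refine fun h' => h (Submodule.span_mono ?_ h')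
  rintro _ ⟨I, hI, rfl⟩
  exact ⟨I, hI, rfl⟩

variable [IsScalarTower ℂ U M]

/-- The leading part of `G_{1/2} L_{-2}^{j+1}`. -/
theorem G_half_smul_L_pow (hv : IsVacuumLike v) (j : ℕ) :
    G 0 • L (-2) ^ (j + 1) • v - (3 / 2 * ((j : ℂ) + 1)) • G (-2) • L (-2) ^ j • v ∈
      wordSpan v (j + 1) := by
  have hGL : ∀ x : M, G 0 • L (-2) • x = L (-2) • G 0 • x + (3 / 2 : ℂ) • G (-2) • x := by
    intro x
    rw [← mul_smul, G_mul_L, add_smul, mul_smul, smul_assoc, add_zero]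
    norm_num
  have hLG : ∀ x : M, L (-2) • G (-2) • x = G (-2) • L (-2) • x + (1 / 2 : ℂ) • G (-4) • x := by
    intro x
    rw [← mul_smul, L_mul_G, add_smul, mul_smul, smul_assoc]
    norm_num
  induction j with
  | zero =>
    rw [zero_add, pow_one, pow_zero, one_smul, hGL, hv.G_smul 0 (by norm_num), smul_zero, zero_add,
      Nat.cast_zero, zero_add, mul_one, sub_self]
    exact zero_mem _
  | succ j ih =>
    have h1 := neg_smul_mem_wordSpan v (g := Gen.L (-2)) (le_refl (-2 : ℤ)) ih
    have h2 := neg_smul_mem_wordSpan v (g := Gen.G (-4)) (by simp [Gen.IsNeg])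
      (L_pow_mem_wordSpan v (Nat.lt_succ_self j))
    have h3 := add_mem h1 (Submodule.smul_mem _ (3 / 4 * ((j : ℂ) + 1)) h2)
    convert h3 using 1
    simp only [gen]
    rw [pow_succ' _ (j + 1), mul_smul, hGL, smul_sub, smul_comm_complex, hLG,
      ← mul_smul (L (-2)) (L (-2) ^ j) v, ← pow_succ']
    push_cast
    rw [smul_add]
    have e : ∀ A B D : M, A + (3 / 2 : ℂ) • B - (3 / 2 * ((j : ℂ) + 1 + 1)) • B =
        A - ((3 / 2 * ((j : ℂ) + 1)) • B + (3 / 2 * ((j : ℂ) + 1)) • (1 / 2 : ℂ) • D) +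
          (3 / 4 * ((j : ℂ) + 1)) • D := by
      intro A B D
      module
    exact e _ _ _

/-- The leading part of `G_{1/2} G_{-3/2} G_{-5/2} L_{-2}^k`. -/
theorem G_half_smul_gg (hv : IsVacuumLike v) (k : ℕ) :
    G 0 • G (-2) • G (-3) • L (-2) ^ k • v + (2 : ℂ) • G (-2) • L (-2) ^ (k + 1) • v ∈
      wordSpan v (k + 2) := by
  have h02 : ∀ x : M, G 0 • G (-2) • x = -(G (-2) • G 0 • x) + (2 : ℂ) • L (-1) • x := by
    intro x
    rw [← mul_smul, G_mul_G, add_smul, add_smul, neg_smul, mul_smul, smul_assoc, smul_assoc]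
    norm_num
  have h03 : ∀ x : M, G 0 • G (-3) • x = -(G (-3) • G 0 • x) + (2 : ℂ) • L (-2) • x := by
    intro x
    rw [← mul_smul, G_mul_G, add_smul, add_smul, neg_smul, mul_smul, smul_assoc, smul_assoc]
    norm_num
  have h32 : ∀ x : M, G (-3) • G (-2) • x = -(G (-2) • G (-3) • x) + (2 : ℂ) • L (-4) • x := by
    intro x
    rw [← mul_smul, G_mul_G, add_smul, add_smul, neg_smul, mul_smul, smul_assoc, smul_assoc]
    norm_num
  have hg2 : (Gen.G (-2)).IsNeg := le_refl (-2 : ℤ)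
  have hg3 : (Gen.G (-3)).IsNeg := by simp [Gen.IsNeg]
  have hl3 : (Gen.L (-3)).IsNeg := by simp [Gen.IsNeg]
  have hl4 : (Gen.L (-4)).IsNeg := by simp [Gen.IsNeg]
  have h1 : L (-1) • G (-3) • L (-2) ^ k • v ∈ wordSpan v (k + 2) :=
    nonneg_smul_mem_wordSpan hv (g := Gen.L (-1)) (by simp [Gen.IsNeg])
      (neg_smul_mem_wordSpan v hg3 (L_pow_mem_wordSpan v (Nat.lt_succ_self k)))
  have h2 : G (-2) • G (-3) • G 0 • L (-2) ^ k • v ∈ wordSpan v (k + 2) := by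
    rcases k with _ | j
    · rw [pow_zero, one_smul, hv.G_smul 0 (by norm_num), smul_zero, smul_zero]
      exact zero_mem _
    · have h4 := neg_smul_mem_wordSpan v hg2
        (neg_smul_mem_wordSpan v hg3 (G_half_smul_L_pow hv j))
      have hL := L_pow_mem_wordSpan v (Nat.lt_succ_self j)
      have h5 := neg_smul_mem_wordSpan v hl3 (neg_smul_mem_wordSpan v hg3 hL)
      have h6 := neg_smul_mem_wordSpan v hg2 (neg_smul_mem_wordSpan v hl4 hL)
      have h7 : G (-2) • G (-3) • G (-2) • L (-2) ^ j • v ∈ wordSpan v (j + 1 + 2) := by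
        rw [h32, smul_add, smul_neg, smul_comm_complex, ← mul_smul (G (-2)) (G (-2)), G_mul_self]
        exact add_mem (neg_mem h5) (Submodule.smul_mem _ _ h6)
      have h8 := add_mem h4 (Submodule.smul_mem _ (3 / 2 * ((j : ℂ) + 1)) h7)
      convert h8 using 1
      simp only [gen]
      rw [smul_sub, smul_sub, smul_comm_complex, smul_comm_complex, sub_add_cancel]
  have h3 := add_mem h2 (Submodule.smul_mem _ (2 : ℂ) h1)
  convert h3 using 1
  rw [h02, h03, smul_add, smul_neg, smul_comm_complex, ← mul_smul (L (-2)), ← pow_succ']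
  have e : ∀ A B D : M, -(-A + (2 : ℂ) • B) + (2 : ℂ) • D + (2 : ℂ) • B = A + (2 : ℂ) • D := by
    intro A B D
    module
  exact e _ _ _

/-- The leading terms of a singular vector of degree `2 (k + 2)` in a cyclic module with vacuum-like
generator that maps to the Fock space. -/
theorem leading_even (hv : IsVacuumLike v) (hcyc : ∀ x : M, ∃ u : U, x = u • v)
    (hφ : ∀ (u : U) (x : M), φ (u • x) = fockRep κ u (φ x)) (hφv : φ v = vacuum) {x : M}
    (hx : IsSingular x) (k : ℕ) (hL0 : L 0 • x = (2 * (k + 2) : ℂ) • x) :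
    ∃ a : ℂ, a ≠ 0 ∧ a • x - ((G (-3) * G (-2) * L (-2) ^ k) • v +
      (-4 / (3 * ((k : ℂ) + 2))) • L (-2) ^ (k + 2) • v) ∈ monSpan v (k + 2) := by
  obtain ⟨hx0, hxL, hxG⟩ := hx
  have hli := linearIndependent_mon hφ hφv
  obtain ⟨c, hc⟩ := exists_decomposition hv hcyc hli hL0
  have hne : lIndex (k + 2) ≠ ggIndex k := fun h => by
    have := congrArg MonIndex.gs h
    simp [lIndex, ggIndex] at this
  classical
  have hE := hc {lIndex (k + 2), ggIndex k} (k + 2) (by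
    intro I hI hIT
    have hI' : I.level = ((4 * ((k + 2 : ℕ) : ℤ) : ℤ) : ℂ) / 2 := by
      rw [hI]; push_cast; ring
    rcases length_lt_or_eq_of_level hI' (Or.inl rfl) with h | ⟨-, h | ⟨k', hk, h⟩⟩ | ⟨h, -⟩
    · exact h
    · exact absurd (by simp [h]) hIT
    · obtain rfl : k = k' := by omega
      exact absurd (by simp [h]) hIT
    · omega)
  rw [Finset.sum_pair hne] at hE
  set b := c (lIndex (k + 2))
  set a := c (ggIndex k)
  set E := x - (b • (lIndex (k + 2)).mon • v + a • (ggIndex k).mon • v) with hEdef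
  have hxE : x = b • (lIndex (k + 2)).mon • v + a • (ggIndex k).mon • v + E := by
    rw [hEdef]; abel
  -- only `L_{-2}^m` reaches the weight `4 m`, where the singular vector has a non-zero coefficient
  have hb : b ≠ 0 := by
    intro hb0
    have h1 : φ x ≠ 0 := fun h => hx0 (fockMap_injective hv hcyc hφ hφv (by rw [h, map_zero]))
    have h2 : φ x ∈ fockLE (4 * k + 7) := by
      rw [hxE, hb0, zero_smul, zero_add, map_add, map_smul]
      refine add_mem (Submodule.smul_mem _ _ ?_) ?_
      · refine fockLE_mono ?_ (fockMap_mon_mem hφ hφv (ggIndex k))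
        simp [ggIndex]; omega
      · refine fockLE_mono ?_ (fockMap_monSpan hφ hφv hE)
        push_cast; omega
    have e0 := hφ (L 0) x
    rw [hL0, map_smul, fockRep_L] at e0
    obtain ⟨j, ⟨h3, h4⟩ | ⟨h3, h4⟩⟩ := exists_top h1
      (fun n hn => by rw [← fockRep_L, ← hφ, hxL n hn, map_zero])
      (fun n hn => by rw [← fockRep_G, ← hφ, hxG n hn, map_zero]) e0.symm
    · have h5 : j = 2 * (k + 2) := by exact_mod_cast h4
      refine h3 (mem_fockLE_iff.mp h2 _ ?_)
      simp only [Occ.wt, Finsupp.degree_single, Finsupp.single_eq_same, Finset.card_empty, h5]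
      push_cast
      omega
    · have h5 : 2 * (j : ℂ) + 1 = 4 * (k + 2) := by linear_combination 2 * h4
      have h6 : 2 * j + 1 = 4 * (k + 2) := by exact_mod_cast h5
      omega
  -- the `G_{1/2}`-condition relates the two leading coefficients
  have hab : a = 3 / 4 * ((k : ℂ) + 2) * b := by
    by_contra hne
    have hy := glIndex_notMem_monSpan hli (k + 1)
    apply hy
    have h1 := G_half_smul_L_pow hv (k + 1)
    have h2 := G_half_smul_gg hv k
    have h3 : G 0 • E ∈ wordSpan v (k + 2) :=
      nonneg_smul_mem_wordSpan hv (g := Gen.G 0) (by simp [Gen.IsNeg])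
        (monSpan_le_wordSpan v _ hE)
    have h4 := hxG 0 le_rfl
    rw [hxE, smul_add, smul_add, smul_comm_complex, smul_comm_complex, mon_lIndex, mon_ggIndex,
      mul_smul, mul_smul] at h4
    have h5 := add_mem (add_mem (Submodule.smul_mem _ b h1) (Submodule.smul_mem _ a h2)) h3
    have e : ∀ A B D F : M, b • A + a • B + F = 0 →
        b • (A - (3 / 2 * (((k + 1 : ℕ) : ℂ) + 1)) • D) + a • (B + (2 : ℂ) • D) + F =
          (2 * (a - 3 / 4 * ((k : ℂ) + 2) * b)) • D := by
      intro A B D F h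
      rw [← sub_eq_zero, ← h]
      push_cast
      module
    rw [e _ _ _ _ h4] at h5
    have hne' : 2 * (a - 3 / 4 * ((k : ℂ) + 2) * b) ≠ 0 :=
      mul_ne_zero two_ne_zero (sub_ne_zero.mpr hne)
    have h6 := wordSpan_le_monSpan v _ ((Submodule.smul_mem_iff _ hne').mp h5)
    rwa [mon_glIndex, mul_smul]
  have hk : ((k : ℂ) + 2) ≠ 0 := by exact_mod_cast Nat.succ_ne_zero (k + 1)
  have ha : a ≠ 0 := by
    rw [hab]; exact mul_ne_zero (mul_ne_zero (by norm_num) hk) hb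
  refine ⟨-a⁻¹, neg_ne_zero.mpr (inv_ne_zero ha), ?_⟩
  -- reordering `G_{-3/2} G_{-5/2}` produces the lower term `2 L_{-4} L_{-2}^k`
  have h4 : L (-4) • L (-2) ^ k • v ∈ monSpan v (k + 2) :=
    wordSpan_le_monSpan v _ (neg_smul_mem_wordSpan v (g := Gen.L (-4)) (by simp [Gen.IsNeg])
      (L_pow_mem_wordSpan v (Nat.lt_succ_self k)))
  have h5 := add_mem (Submodule.smul_mem _ (-a⁻¹) hE) (Submodule.smul_mem _ (-2 : ℂ) h4)
  convert h5 using 1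
  have h23 : (ggIndex k).mon • v =
      -((G (-3) * G (-2) * L (-2) ^ k) • v) + (2 : ℂ) • L (-4) • L (-2) ^ k • v := by
    rw [mon_ggIndex, mul_smul, G_mul_G, add_smul, add_smul, neg_smul, smul_assoc, smul_assoc,
      ← mul_smul]
    norm_num
  have hlam : -4 / (3 * ((k : ℂ) + 2)) = -(a⁻¹ * b) := by
    rw [hab]; field_simp
  rw [hxE, h23, mon_lIndex, hlam]
  have e : ∀ A B D F : M, (-a⁻¹) • (b • B + a • (-A + (2 : ℂ) • D) + F) - (A + (-(a⁻¹ * b)) • B) =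
      (-a⁻¹) • F + (-2 : ℂ) • D := by
    intro A B D F
    have h1 : (-a⁻¹) • (b • B + a • (-A + (2 : ℂ) • D) + F) =
        (-(a⁻¹ * b)) • B + (a⁻¹ * a) • (A - (2 : ℂ) • D) - a⁻¹ • F := by module
    rw [h1, inv_mul_cancel₀ ha]
    module
  exact e _ _ _ _

/-- The leading term of a singular vector of degree `2 k + 3/2` in a cyclic module with vacuum-like
generator that maps to the Fock space. -/
theorem leading_odd (hv : IsVacuumLike v) (hcyc : ∀ x : M, ∃ u : U, x = u • v)
    (hφ : ∀ (u : U) (x : M), φ (u • x) = fockRep κ u (φ x)) (hφv : φ v = vacuum) {x : M}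
    (hx : IsSingular x) (k : ℕ) (hL0 : L 0 • x = ((4 * k + 3) / 2 : ℂ) • x) :
    ∃ a : ℂ, a ≠ 0 ∧ a • x - (G (-2) * L (-2) ^ k) • v ∈ monSpan v (k + 1) := by
  obtain ⟨hx0, hxL, hxG⟩ := hx
  obtain ⟨c, hc⟩ := exists_decomposition hv hcyc (linearIndependent_mon hφ hφv) hL0
  have hE := hc {glIndex k} (k + 1) (by
    intro I hI hIT
    have hI' : I.level = ((4 * (k : ℤ) + 3 : ℤ) : ℂ) / 2 := by
      rw [hI]; push_cast; ring
    rcases length_lt_or_eq_of_level hI' (d := k + 1) (Or.inr (by push_cast; ring)) with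
      h | ⟨h, -⟩ | ⟨-, k', hk, h⟩
    · exact h
    · omega
    · obtain rfl : k = k' := by omega
      exact absurd (by simp [h]) hIT)
  rw [Finset.sum_singleton] at hE
  set b := c (glIndex k)
  -- only `G_{-3/2} L_{-2}^k` reaches the weight `4 k + 3`, where the singular vector has a non-zero
  -- coefficient
  have hb : b ≠ 0 := by
    intro hb0
    rw [hb0, zero_smul, sub_zero] at hE
    have h1 : φ x ≠ 0 := fun h => hx0 (fockMap_injective hv hcyc hφ hφv (by rw [h, map_zero]))
    have h2 := fockMap_monSpan hφ hφv hE
    have e0 := hφ (L 0) x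
    rw [hL0, map_smul, fockRep_L] at e0
    obtain ⟨j, ⟨h3, h4⟩ | ⟨h3, h4⟩⟩ := exists_top h1
      (fun n hn => by rw [← fockRep_L, ← hφ, hxL n hn, map_zero])
      (fun n hn => by rw [← fockRep_G, ← hφ, hxG n hn, map_zero]) e0.symm
    · have h5 : 2 * (j : ℂ) = 4 * k + 3 := by linear_combination 2 * h4
      have h6 : 2 * j = 4 * k + 3 := by exact_mod_cast h5
      omega
    · have h5 : 2 * (j : ℂ) + 1 = 4 * k + 3 := by linear_combination 2 * h4
      have h6 : 2 * j + 1 = 4 * k + 3 := by exact_mod_cast h5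
      refine h3 (mem_fockLE_iff.mp h2 _ ?_)
      simp only [Occ.wt, Finsupp.degree_single, Finsupp.single_eq_same, Finset.card_singleton]
      push_cast
      omega
  refine ⟨b⁻¹, inv_ne_zero hb, ?_⟩
  have h := Submodule.smul_mem _ b⁻¹ hE
  rwa [smul_sub, smul_smul, inv_mul_cancel₀ hb, one_smul, mon_glIndex] at h

end Leading

/-! ### The quotient of the Verma module -/

theorem isVacuumLike_vac' (p q : ℤ) : IsVacuumLike (vac' p q) := by
  have hmk : ∀ u : U, u ∈ vermaIdeal (cMin p q) 0 → u • vac' p q = 0 := by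
    intro u hu
    have h : u • vac (cMin p q) 0 = 0 := by
      rw [vac, ← map_smul, smul_eq_mul, mul_one]
      exact (Submodule.Quotient.mk_eq_zero _).mpr hu
    rw [vac', ← map_smul, h, map_zero]
  have hG1 : G (-1) • vac' p q = 0 := by
    rw [vac', ← map_smul]
    exact (Submodule.Quotient.mk_eq_zero _).mpr (Submodule.subset_span rfl)
  refine ⟨fun n hn => ?_, fun k hk => ?_, cMin p q, ?_⟩
  · rcases lt_trichotomy n 0 with h | rfl | h
    · obtain rfl : n = 2 * (-1) + 1 := by omega
      rw [← G_mul_self, mul_smul, hG1, smul_zero]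
    · have := hmk (L 0 - algebraMap ℂ U 0) (Submodule.subset_span (by simp))
      simpa using this
    · exact hmk _ (Submodule.subset_span (Or.inl (Or.inl ⟨n, h, rfl⟩)))
  · rcases hk.eq_or_lt with rfl | h
    · exact hG1
    · exact hmk _ (Submodule.subset_span (Or.inl (Or.inr ⟨k, by omega, rfl⟩)))
  · have := hmk (C - algebraMap ℂ U (cMin p q)) (Submodule.subset_span (by simp))
    rwa [sub_smul, algebraMap_smul, sub_eq_zero] at this

theorem exists_smul_vac' (p q : ℤ) (x : VPrime p q) : ∃ u : U, x = u • vac' p q := by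
  obtain ⟨y, rfl⟩ := Submodule.mkQ_surjective _ x
  obtain ⟨u, rfl⟩ := Submodule.mkQ_surjective _ y
  refine ⟨u, ?_⟩
  rw [vac', ← map_smul, vac, ← map_smul, smul_eq_mul, mul_one]
  rfl

/-- Combinations of monomials with at most `d` factors are lower than any sequence with
`β_0 > d`. -/
theorem isLower_of_mem_monSpan {p q : ℤ} {d : ℕ} {x : VPrime p q}
    (hx : x ∈ monSpan (vac' p q) (d + 1)) {α : Lex (ℕ →₀ ℕ)} (hα : d < ofLex α 0) :
    IsLower p q α x := by
  -- the sequence `(d, d + 1, 0, …)` bounds those of all monomials with at most `d` factors, as a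
  -- monomial with `d` factors has `β_1 ≤ d`
  refine ⟨toLex (Finsupp.single 0 d + Finsupp.single 1 (d + 1)), ?_, ?_⟩
  · rw [Finsupp.Lex.lt_iff]
    refine ⟨0, fun j hj => absurd hj (Nat.not_lt_zero j), ?_⟩
    simpa using hα
  · refine Submodule.span_mono ?_ hx
    rintro _ ⟨I, hI, rfl⟩
    refine ⟨I, le_of_lt ?_, rfl⟩
    rw [Finsupp.Lex.lt_iff]
    have h0 := I.deg_apply_zero
    have h1 := I.deg_apply_one_le
    by_cases h : I.gs.length + I.ls.length = d
    · refine ⟨1, fun j hj => ?_, ?_⟩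
      · obtain rfl : j = 0 := by omega
        rw [h0, h]; simp
      · simp only [ofLex_toLex, Finsupp.add_apply, Finsupp.single_eq_same]
        omega
    · refine ⟨0, fun j hj => absurd hj (Nat.not_lt_zero j), ?_⟩
      rw [h0]
      simp only [ofLex_toLex, Finsupp.add_apply, Finsupp.single_eq_same]
      omega

theorem isSingular_proj {p q : ℤ} {w : Verma (cMin p q) 0} (hw : IsSecondSingular p q w) :
    IsSingular (proj p q w) := by
  obtain ⟨⟨-, hL, hG⟩, -, hmem⟩ := hw
  refine ⟨fun h => hmem ((Submodule.Quotient.mk_eq_zero _).mp h), fun n hn => ?_, fun k hk => ?_⟩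
  · rw [← map_smul, hL n hn, map_zero]
  · rw [← map_smul, hG k hk, map_zero]

theorem L_zero_smul_proj {p q : ℤ} {w : Verma (cMin p q) 0} (hw : IsSecondSingular p q w) :
    L 0 • proj p q w = (((p : ℂ) - 1) * ((q : ℂ) - 1) / 2) • proj p q w := by
  rw [← map_smul, hw.2.1]
  exact LinearMap.map_smul_of_tower (proj p q) _ w

theorem exists_eq_of_even {p q : ℤ} (hp : 2 ≤ p) (hq : 2 ≤ q) (hpq : p ≡ q [ZMOD 2])
    (hgcd : Int.gcd p ((p - q) / 2) = 1) (h : Even ((p - 1) * (q - 1))) :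
    ∃ k : ℕ, 4 * ((k : ℤ) + 2) = (p - 1) * (q - 1) := by
  have hpq' : p % 2 = q % 2 := hpq
  obtain ⟨s, rfl⟩ : ∃ s, p = 2 * s + 1 := by
    rcases Int.even_or_odd' p with ⟨s, rfl | rfl⟩
    · obtain ⟨t, rfl⟩ : ∃ t, q = 2 * t := ⟨q / 2, by omega⟩
      rw [Int.even_mul] at h
      rcases h with ⟨r, hr⟩ | ⟨r, hr⟩ <;> omega
    · exact ⟨s, rfl⟩
  obtain ⟨t, rfl⟩ : ∃ t, q = 2 * t + 1 := ⟨q / 2, by omega⟩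
  -- `s = t = 1` is `p = q = 3`, excluded by `gcd(p, 0) = p`
  have hst : 2 ≤ s * t := by
    have hs : 1 ≤ s := by omega
    have ht : 1 ≤ t := by omega
    by_contra! hlt
    have hs1 : s = 1 := by nlinarith
    have ht1 : t = 1 := by nlinarith
    subst hs1 ht1
    norm_num at hgcd
  refine ⟨(s * t - 2).toNat, ?_⟩
  rw [Int.toNat_of_nonneg (by omega)]
  ring

theorem exists_eq_of_odd {p q : ℤ} (hp : 2 ≤ p) (hq : 2 ≤ q)
    (hgcd : Int.gcd p ((p - q) / 2) = 1) (h : Odd ((p - 1) * (q - 1))) :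
    ∃ k : ℕ, 4 * (k : ℤ) + 3 = (p - 1) * (q - 1) := by
  rw [Int.odd_mul] at h
  obtain ⟨⟨s, hs⟩, ⟨t, ht⟩⟩ := h
  obtain rfl : p = 2 * (s + 1) := by omega
  obtain rfl : q = 2 * (t + 1) := by omega
  -- for even `p` the number `(p - q) / 2` is odd
  have hodd : ¬ (2 : ℤ) ∣ s - t := by
    intro hdvd
    have h1 : (2 : ℤ) ∣ (2 * (s + 1) - 2 * (t + 1)) / 2 := by
      rwa [show (2 * (s + 1) - 2 * (t + 1)) / 2 = s - t by omega]
    have h2 := Int.dvd_coe_gcd (Dvd.intro (s + 1) rfl) h1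
    rw [hgcd] at h2
    norm_num at h2
  obtain ⟨u, hu⟩ : ∃ u, s = t + 2 * u + 1 := ⟨(s - t) / 2, by omega⟩
  subst hu
  have hpos : 0 ≤ (t + 2 * u + 1) * t := mul_nonneg (by omega) (by omega)
  refine ⟨((t + 2 * u + 1) * t + t + u).toNat, ?_⟩
  rw [Int.toNat_of_nonneg (by
    have : 0 ≤ t + u := by omega
    omega)]
  ring

end NeveuSchwarz

theorem mainTheorem7 (p q : ℤ) (hp : 2 ≤ p) (hq : 2 ≤ q) (hpq : p ≡ q [ZMOD 2])
    (hgcd : Int.gcd p ((p - q) / 2) = 1) :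
    (Even ((p - 1) * (q - 1)) →
      ∃ k m : ℕ, 4 * ((k : ℤ) + 2) = (p - 1) * (q - 1) ∧ 4 * (m : ℤ) = (p - 1) * (q - 1) ∧
        ∃ lam : ℂ, lam ≠ 0 ∧
          ∀ w : NeveuSchwarz.Verma (NeveuSchwarz.cMin p q) 0,
            NeveuSchwarz.IsSecondSingular p q w →
            ∃ a : ℂ, a ≠ 0 ∧ ∃ e : NeveuSchwarz.VPrime p q,
              NeveuSchwarz.IsLower p q (NeveuSchwarz.lIndex m).deg e ∧
              a • NeveuSchwarz.proj p q w =
                (NeveuSchwarz.G (-3) * NeveuSchwarz.G (-2) * NeveuSchwarz.L (-2) ^ k) •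
                    NeveuSchwarz.vac' p q +
                  lam • (NeveuSchwarz.L (-2) ^ m • NeveuSchwarz.vac' p q) + e) ∧
    (Odd ((p - 1) * (q - 1)) →
      ∃ k : ℕ, 4 * (k : ℤ) + 3 = (p - 1) * (q - 1) ∧
        ∀ w : NeveuSchwarz.Verma (NeveuSchwarz.cMin p q) 0,
          NeveuSchwarz.IsSecondSingular p q w →
          ∃ a : ℂ, a ≠ 0 ∧ ∃ e : NeveuSchwarz.VPrime p q,
            NeveuSchwarz.IsLower p q (NeveuSchwarz.glIndex k).deg e ∧
            a • NeveuSchwarz.proj p q w =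
              (NeveuSchwarz.G (-2) * NeveuSchwarz.L (-2) ^ k) • NeveuSchwarz.vac' p q + e) := by
  classical
  obtain ⟨κ, hκ⟩ := NeveuSchwarz.exists_backgroundCharge p q
  obtain ⟨φ, hφ, hφv⟩ := NeveuSchwarz.exists_fockMap hκ
  have hv := NeveuSchwarz.isVacuumLike_vac' p q
  have hcyc := NeveuSchwarz.exists_smul_vac' p q
  refine ⟨fun h => ?_, fun h => ?_⟩
  · obtain ⟨k, hk⟩ := NeveuSchwarz.exists_eq_of_even hp hq hpq hgcd h
    have hk' : (4 : ℂ) * (k + 2) = (p - 1) * (q - 1) := by exact_mod_cast hk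
    have hk2 : ((k : ℂ) + 2) ≠ 0 := by exact_mod_cast Nat.succ_ne_zero (k + 1)
    refine ⟨k, k + 2, hk, by exact_mod_cast hk, -4 / (3 * ((k : ℂ) + 2)),
      div_ne_zero (by norm_num) (mul_ne_zero (by norm_num) hk2), fun w hw => ?_⟩
    have hL0 := NeveuSchwarz.L_zero_smul_proj hw
    rw [← hk', show (4 : ℂ) * (k + 2) / 2 = 2 * (k + 2) by ring] at hL0
    obtain ⟨a, ha, hmem⟩ := NeveuSchwarz.leading_even hv hcyc hφ hφv
      (NeveuSchwarz.isSingular_proj hw) k hL0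
    refine ⟨a, ha, _, NeveuSchwarz.isLower_of_mem_monSpan hmem ?_, (add_sub_cancel _ _).symm⟩
    rw [NeveuSchwarz.MonIndex.deg_apply_zero]
    simp [NeveuSchwarz.lIndex]
  · obtain ⟨k, hk⟩ := NeveuSchwarz.exists_eq_of_odd hp hq hgcd h
    have hk' : (4 : ℂ) * k + 3 = (p - 1) * (q - 1) := by exact_mod_cast hk
    refine ⟨k, hk, fun w hw => ?_⟩
    have hL0 := NeveuSchwarz.L_zero_smul_proj hw
    rw [← hk'] at hL0
    obtain ⟨a, ha, hmem⟩ := NeveuSchwarz.leading_odd hv hcyc hφ hφv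
      (NeveuSchwarz.isSingular_proj hw) k hL0
    refine ⟨a, ha, _, NeveuSchwarz.isLower_of_mem_monSpan hmem ?_, (add_sub_cancel _ _).symm⟩
    rw [NeveuSchwarz.MonIndex.deg_apply_zero]
    simp [NeveuSchwarz.glIndex]
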